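/- **Setting.** Let $V$ be a finite set with $n$ elements. A correlation clustering instance $G$ on $V$ consists of two simple graphs $G^+=(V,E^+)$ (similar pairs) and $G^-=(V,E^-)$ (dissimilar pairs) with nonnegative edge weights $w^+_{ij}$, $w^-_{ij}$; put $E=E^+\cup E^-$. The value in $G$ of a clustering (partition of $V$) is $$\mathcal C=\sum_{ij\in E^-}w^-_{ij}\mathbf 1_{[i,j\text{ in different clusters}]}+\sum_{ij\in E^+}w^+_{ij}\mathbf 1_{[i,j\text{ in the same cluster}]},$$ each edge being counted once, and $\mathrm{opt}^G_{CC}$ is its maximum over all clusterings. Let $L_H$ be the weighted Laplacian of a graph $H$, let $W^+$ be the weighted adjacency matrix of $G^+$, let $C=L_{G^-}+W^+$, and let $\langle A,B\rangle=\mathrm{Tr}(A^TB)$. The relaxation (MA-Rel) of $G$ is to maximize $\langle C,X\rangle$ over $X\succeq0$ with $X_{ii}=1$ for all $i$ and $X_{ij}\ge0$ for $(i,j)\in E$. Two graphs $H,\tilde H$ on $V$ are $\tau$-spectrally close if $(1-\tau)x^TL_Hx\le x^TL_{\tilde H}x\le(1+\tau)x^TL_Hx$ for all $x\in\mathbb R^V$.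 **Procedure.** It is run on an instance $\tilde G$ (with edge set $\tilde E=\tilde E^+\cup\tilde E^-$) and a positive semidefinite matrix $\widehat X$. Let $\mathrm{err}=\max\{0,\max_{(i,j)\in\tilde E}(-\widehat X_{ij})\}$ and $m=\max_i\widehat X_{ii}$. For $l=1,2,3$ draw, all independently, $z_l\sim N(0,\widehat X)$, $y_l\sim N(0,1)$ and $\zeta_l\sim N\big(0,\,I-\mathrm{diag}^*\big(\tfrac{\mathrm{diag}(\widehat X)+\mathrm{err}}{m+\mathrm{err}}\big)\big)$, where $\mathrm{diag}^*(x)$ is the diagonal matrix with diagonal $x$, and set $$z^f_l=\frac{z_l+\sqrt{\mathrm{err}}\;y_l\,\mathbf 1}{\sqrt{m+\mathrm{err}}}+\zeta_l .$$ Then apply Charikar–Guruswami–Wirth (CGW) rounding: independently of these samples let $k=3$ with probability $q$ and $k=2$ with probability $1-q$, and put two vertices $i,j$ into the same cluster if and only if $[z^f_l]_i$ and $[z^f_l]_j$ have the same sign for every $l\le k$. Here $q$ is any fixed number in $[0.13,0.133]$, for instance $q=0.1316$. **Lemma.** Let $\epsilon,\tau\in(0,1/9)$. Let $G$ and $\tilde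 G$ be instances on $V$ such that $\tilde G^+$ is $\tau$-spectrally close to $G^+$ and $\tilde G^-$ is $\tau$-spectrally close to $G^-$. Let $\tilde C=L_{\tilde G^-}+\tilde W^+$ be the cost matrix of $\tilde G$, let $X^\star_{\tilde G}$ be an optimal solution of (MA-Rel) for $\tilde G$, and let $\widehat X\succeq0$ be near-optimal and near-feasible, in the sense that $$(1-4\epsilon)\langle\tilde C,X^\star_{\tilde G}\rangle\le\langle\tilde C,\widehat X\rangle\le(1+4\epsilon)\langle\tilde C,X^\star_{\tilde G}\rangle,\qquad |\widehat X_{ii}-1|\le\epsilon\ \ (i\in V),\qquad \widehat X_{ij}\ge-\epsilon\ \ ((i,j)\in\tilde E).$$ Run the procedure on $\tilde G$ and $\widehat X$, and let $\mathcal C$ be the value in the original instance $G$ of the resulting random clustering. Then $\mathcal C$ is integrable and $$0.766\,(1-6\epsilon-3\tau)(1-\tau^2)\,\mathrm{opt}^G_{CC}\ \le\ \mathbb E[\mathcal C]\ \le\ \mathrm{opt}^G_{CC}.$$ -/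

import Mathlib

open MeasureTheory ProbabilityTheory

namespace CorrClust

/-- A finite simple graph with nonnegative edge weights. -/
structure WGraph (V : Type*) where
  graph : SimpleGraph V
  weight : V → V → ℝ
  weight_symm : ∀ i j, weight i j = weight j i
  weight_nonneg : ∀ i j, 0 ≤ weight i j
  weight_eq_zero : ∀ i j, ¬ graph.Adj i j → weight i j = 0

/-- An instance of correlation clustering on the vertex set `V`: the graph `pos` of similar pairs
and the graph `neg` of dissimilar pairs, both weighted. -/
structure Instance (V : Type*) where
  pos : WGraph V
  neg : WGraph V

variable {V : Type*}

/-- The union of the two edge sets. -/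
def Instance.edges (G : Instance V) : SimpleGraph V := G.pos.graph ⊔ G.neg.graph

section Matrices

variable [Fintype V] [DecidableEq V]

/-- The weighted adjacency matrix. -/
def WGraph.adj (H : WGraph V) : Matrix V V ℝ := Matrix.of H.weight

/-- The weighted graph Laplacian, that is, degree matrix minus adjacency matrix. -/
def WGraph.lap (H : WGraph V) : Matrix V V ℝ :=
  Matrix.diagonal (fun i => ∑ j, H.weight i j) - H.adj

/-- `H'` is `τ`-spectrally close to `H`. -/
def SpectrallyClose (τ : ℝ) (H H' : WGraph V) : Prop :=
  ∀ x : V → ℝ,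
    (1 - τ) * (x ⬝ᵥ H.lap.mulVec x) ≤ x ⬝ᵥ H'.lap.mulVec x ∧
      x ⬝ᵥ H'.lap.mulVec x ≤ (1 + τ) * (x ⬝ᵥ H.lap.mulVec x)

/-- The matrix inner product `Tr(Aᵀ B)`. -/
def innerMat (A B : Matrix V V ℝ) : ℝ := (A.transpose * B).trace

/-- The cost matrix `L_{G⁻} + W⁺`. -/
def Instance.cost (G : Instance V) : Matrix V V ℝ := G.neg.lap + G.pos.adj

/-- Feasibility for the semidefinite relaxation of Max-Agree in which the sign constraint is
imposed on the edges only. -/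
structure Instance.IsFeasible (G : Instance V) (X : Matrix V V ℝ) : Prop where
  posSemidef : X.PosSemidef
  diag_eq_one : ∀ i, X i i = 1
  nonneg_of_adj : ∀ i j, G.edges.Adj i j → 0 ≤ X i j

/-- Optimal solutions of that relaxation, whose objective is `⟨C, X⟩`. -/
def Instance.IsOptimal (G : Instance V) (X : Matrix V V ℝ) : Prop :=
  G.IsFeasible X ∧ ∀ Y, G.IsFeasible Y → innerMat G.cost Y ≤ innerMat G.cost X

/-- `X` is near-optimal and near-feasible (with parameter `ε`) for the relaxation, of which `Xopt`
is an optimal solution. -/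
structure Instance.IsNearSolution (G : Instance V) (ε : ℝ) (Xopt X : Matrix V V ℝ) : Prop where
  posSemidef : X.PosSemidef
  lower_optimal : (1 - 4 * ε) * innerMat G.cost Xopt ≤ innerMat G.cost X
  upper_optimal : innerMat G.cost X ≤ (1 + 4 * ε) * innerMat G.cost Xopt
  diag_near_one : ∀ i, |X i i - 1| ≤ ε
  near_nonneg : ∀ i j, G.edges.Adj i j → -ε ≤ X i j

end Matrices

section Clusterings

variable [Fintype V]

open Classical in
/-- The value of a clustering (an equivalence relation on `V` whose classes are the clusters):
negative weight between different clusters plus positive weight inside clusters. Every unordered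
pair is counted once, whence the factor `1 / 2` in front of the sum over ordered pairs. -/
noncomputable def Instance.value (G : Instance V) (P : Setoid V) : ℝ :=
  (1 / 2) * ∑ i, ∑ j,
    ((if P i j then 0 else G.neg.weight i j) + (if P i j then G.pos.weight i j else 0))

/-- The optimal clustering value. -/
noncomputable def Instance.opt (G : Instance V) : ℝ := ⨆ P : Setoid V, G.value P

end Clusterings

section Rounding

variable [Fintype V] [DecidableEq V]

/-- The largest violation `max {0, max_{ij ∈ E} (- X i j)}` of the sign constraints. -/
noncomputable def Instance.err (G : Instance V) (X : Matrix V V ℝ) : ℝ :=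
  max 0 (⨆ e : {p : V × V // G.edges.Adj p.1 p.2}, - X e.1.1 e.1.2)

/-- The largest diagonal entry. -/
noncomputable def maxDiag (X : Matrix V V ℝ) : ℝ := ⨆ i, X i i

/-- The covariance `I - diag*((diag X + err) / (max (diag X) + err))` of the correction `ζ`. -/
noncomputable def Instance.correctionCov (G : Instance V) (X : Matrix V V ℝ) : Matrix V V ℝ :=
  1 - Matrix.diagonal (fun i => (X i i + G.err X) / (maxDiag X + G.err X))

/-- One pass of the loop that turns a sample `z` with covariance `X`, a standard normal number `y`
and a correction `ζ` into a sample `(z + √err y 𝟙) / √(max (diag X) + err) + ζ` whose covariance is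
feasible. -/
noncomputable def Instance.feasibleSample (G : Instance V) (X : Matrix V V ℝ)
    (s : EuclideanSpace ℝ V × ℝ × EuclideanSpace ℝ V) : EuclideanSpace ℝ V :=
  (Real.sqrt (maxDiag X + G.err X))⁻¹ •
      (s.1 + WithLp.toLp 2 (fun _ => Real.sqrt (G.err X) * s.2.1)) + s.2.2

/-- The joint law of the independent triple `(z, y, ζ)` with `z ∼ N(0, X)`, `y ∼ N(0, 1)` and
`ζ ∼ N(0, correctionCov)`. -/
noncomputable def Instance.sampleLaw (G : Instance V) (X : Matrix V V ℝ) :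
    Measure (EuclideanSpace ℝ V × ℝ × EuclideanSpace ℝ V) :=
  (multivariateGaussian 0 X).prod
    ((gaussianReal 0 1).prod (multivariateGaussian 0 (G.correctionCov X)))

/-- The law of the number of hyperplanes: `3` with probability `q`, and `2` otherwise. -/
noncomputable def hyperplaneLaw (q : ℝ) : Measure ℕ :=
  ENNReal.ofReal (1 - q) • Measure.dirac 2 + ENNReal.ofReal q • Measure.dirac 3

/-- All the randomness: the number of hyperplanes and, independently of it, three independent
triples `(z, y, ζ)`. -/
noncomputable def Instance.noiseLaw (G : Instance V) (q : ℝ) (X : Matrix V V ℝ) :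
    Measure (ℕ × (Fin 3 → EuclideanSpace ℝ V × ℝ × EuclideanSpace ℝ V)) :=
  (hyperplaneLaw q).prod (Measure.pi fun _ : Fin 3 => G.sampleLaw X)

/-- Rounding by hyperplanes: two vertices share a cluster when they have the same sign in each of
the first `k` samples; this gives at most `2 ^ k` clusters. -/
def signClustering (k : ℕ) (z : Fin 3 → EuclideanSpace ℝ V) : Setoid V where
  r i j := ∀ l : Fin 3, (l : ℕ) < k → (0 ≤ z l i ↔ 0 ≤ z l j)
  iseqv :=
    { refl := fun _ _ _ => Iff.rfl
      symm := fun h l hl => (h l hl).symm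
      trans := fun h h' l hl => (h l hl).trans (h' l hl) }

/-- The clustering produced from the randomness `ω`: generate three samples with feasible
covariance, then round the first two or all three of them. -/
noncomputable def Instance.clustering (G : Instance V) (X : Matrix V V ℝ)
    (ω : ℕ × (Fin 3 → EuclideanSpace ℝ V × ℝ × EuclideanSpace ℝ V)) : Setoid V :=
  signClustering ω.1 (fun l => G.feasibleSample X (ω.2 l))

end Rounding

end CorrClust

open MeasureTheory ProbabilityTheory

namespace CorrClust

/-! Write `R` for the covariance of the corrected samples. It is feasible for the relaxation of the
sparsified instance, and repairing costs little: the shift by `err` cancels in Laplacian terms and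
only helps adjacency terms, while the normalisation is at most `1 + 2ε`, so the objective at `R` is
at least `1 - 6ε` times the optimum. By Sheppard's formula two vertices of correlation `ρ = cos (π
v)` share a cluster with probability `p = (1 - v)² (1 - q v)`, and twice the expected value is the
cost form of the original instance at the matrix of these probabilities.

Spectral closeness compares Laplacian forms at every positive semidefinite matrix, and the 0-1
matrices of clusterings, `R` and the probability matrix are all positive semidefinite with unit
diagonal. Dissimilar weight is a Laplacian form and transfers at once. Similar weight is an
adjacency form, which on unit diagonals equals total weight minus a Laplacian form; the subtraction
turns the multiplicative error into an additive one of order `τ c`, where `c` is the positive cut of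
`R`.

Two lower bounds for `p` absorb that error. If `c` is small, `p ≥ 0.766 ρ` suffices
(`cos_le_agreeProb`). If `c` is large, the flatter line `p ≥ 0.17 + 0.46 ρ` (`line_le_agreeProb`)
charges less for the cut and leaves slack of constant order. `combine_bounds` makes the choice. The
upper bound holds pointwise. -/

/-! ### Numerical bounds on the cosine and on the agreement probability -/

/-- A function on the half line that vanishes at `0` and has nonnegative derivative is
nonnegative. -/
theorem nonneg_of_hasDerivAt_nonneg {f f' : ℝ → ℝ} (h0 : f 0 = 0)
    (hd : ∀ x, HasDerivAt f (f' x) x) (hf' : ∀ x, 0 ≤ x → 0 ≤ f' x) {x : ℝ} (hx : 0 ≤ x) :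
    0 ≤ f x := by
  have hm : MonotoneOn f (Set.Ici 0) := by
    refine monotoneOn_of_deriv_nonneg (convex_Ici 0)
      (fun y _ => (hd y).continuousAt.continuousWithinAt)
      (fun y _ => (hd y).differentiableAt.differentiableWithinAt) fun y hy => ?_
    rw [interior_Ici] at hy
    rw [(hd y).deriv]
    exact hf' y hy.le
  simpa [h0] using hm (Set.mem_Ici.2 le_rfl) hx hx

/-- Start of a chain: the derivative of each Taylor remainder is the previous remainder, so the
signs propagate from the cubic bound on the sine up to degree eight. -/
theorem cos_le_taylor_four {x : ℝ} (hx : 0 ≤ x) :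
    Real.cos x ≤ 1 - x ^ 2 / 2 + x ^ 4 / 24 := by
  have := nonneg_of_hasDerivAt_nonneg (f := fun x => 1 - x ^ 2 / 2 + x ^ 4 / 24 - Real.cos x)
    (f' := fun x => -x + x ^ 3 / 6 + Real.sin x) (by simp) (fun y => by
      have := ((((hasDerivAt_id y).pow 2).div_const 2).const_sub 1).add
        (((hasDerivAt_id y).pow 4).div_const 24) |>.sub (Real.hasDerivAt_cos y)
      exact this.congr_deriv (by simp; ring)) (fun y hy => by have := Real.sin_ge_sub_cube hy; linarith) hx
  linarith

theorem sin_le_taylor_five {x : ℝ} (hx : 0 ≤ x) :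
    Real.sin x ≤ x - x ^ 3 / 6 + x ^ 5 / 120 := by
  have := nonneg_of_hasDerivAt_nonneg (f := fun x => x - x ^ 3 / 6 + x ^ 5 / 120 - Real.sin x)
    (f' := fun x => 1 - x ^ 2 / 2 + x ^ 4 / 24 - Real.cos x) (by simp) (fun y => by
      have := ((hasDerivAt_id y).sub (((hasDerivAt_id y).pow 3).div_const 6)).add
        (((hasDerivAt_id y).pow 5).div_const 120) |>.sub (Real.hasDerivAt_sin y)
      exact this.congr_deriv (by simp; ring)) (fun y hy => by have := cos_le_taylor_four hy; linarith) hx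
  linarith

theorem taylor_six_le_cos {x : ℝ} (hx : 0 ≤ x) :
    1 - x ^ 2 / 2 + x ^ 4 / 24 - x ^ 6 / 720 ≤ Real.cos x := by
  have := nonneg_of_hasDerivAt_nonneg
    (f := fun x => Real.cos x - (1 - x ^ 2 / 2 + x ^ 4 / 24 - x ^ 6 / 720))
    (f' := fun x => x - x ^ 3 / 6 + x ^ 5 / 120 - Real.sin x) (by simp) (fun y => by
      have := (Real.hasDerivAt_cos y).sub
        (((((hasDerivAt_id y).pow 2).div_const 2).const_sub 1).add
        (((hasDerivAt_id y).pow 4).div_const 24) |>.sub (((hasDerivAt_id y).pow 6).div_const 720))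
      exact this.congr_deriv (by simp; ring)) (fun y hy => by have := sin_le_taylor_five hy; linarith) hx
  linarith

theorem taylor_seven_le_sin {x : ℝ} (hx : 0 ≤ x) :
    x - x ^ 3 / 6 + x ^ 5 / 120 - x ^ 7 / 5040 ≤ Real.sin x := by
  have := nonneg_of_hasDerivAt_nonneg
    (f := fun x => Real.sin x - (x - x ^ 3 / 6 + x ^ 5 / 120 - x ^ 7 / 5040))
    (f' := fun x => Real.cos x - (1 - x ^ 2 / 2 + x ^ 4 / 24 - x ^ 6 / 720)) (by simp) (fun y => by
      have := (Real.hasDerivAt_sin y).sub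
        (((hasDerivAt_id y).sub (((hasDerivAt_id y).pow 3).div_const 6)).add
        (((hasDerivAt_id y).pow 5).div_const 120) |>.sub
          (((hasDerivAt_id y).pow 7).div_const 5040))
      exact this.congr_deriv (by simp; ring)) (fun y hy => by have := taylor_six_le_cos hy; linarith) hx
  linarith

theorem cos_le_taylor_eight {x : ℝ} (hx : 0 ≤ x) :
    Real.cos x ≤ 1 - x ^ 2 / 2 + x ^ 4 / 24 - x ^ 6 / 720 + x ^ 8 / 40320 := by
  have := nonneg_of_hasDerivAt_nonneg
    (f := fun x => 1 - x ^ 2 / 2 + x ^ 4 / 24 - x ^ 6 / 720 + x ^ 8 / 40320 - Real.cos x)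
    (f' := fun x => Real.sin x - (x - x ^ 3 / 6 + x ^ 5 / 120 - x ^ 7 / 5040)) (by simp)
    (fun y => by
      have := (((((hasDerivAt_id y).pow 2).div_const 2).const_sub 1).add
        (((hasDerivAt_id y).pow 4).div_const 24) |>.sub (((hasDerivAt_id y).pow 6).div_const 720)
        |>.add (((hasDerivAt_id y).pow 8).div_const 40320)) |>.sub (Real.hasDerivAt_cos y)
      exact this.congr_deriv (by simp; ring)) (fun y hy => by have := taylor_seven_le_sin hy; linarith) hx
  linarith

/-- The probability that two vertices at angle `π v` share a cluster. -/
noncomputable def agreeProb (q v : ℝ) : ℝ := (1 - q) * (1 - v) ^ 2 + q * (1 - v) ^ 3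

theorem agreeProb_nonneg {q v : ℝ} (hq : q ∈ Set.Icc (0.13 : ℝ) 0.133) (hv : v ≤ 1) :
    0 ≤ agreeProb q v := by
  have h1 : 0 ≤ 1 - q := by linarith [hq.2]
  have h2 : 0 ≤ q := by linarith [hq.1]
  have h3 : 0 ≤ 1 - v := by linarith
  unfold agreeProb; positivity

/-- The chord `1 - 2v` lies below the cosine on this range, which leaves a polynomial inequality
whose worst case is `q = 0.13`. It is nearly tight at `v = 1/2`, where it reads `3/4 + q/8 ≥ 0.766`;
this is what bounds `q` from below. -/
theorem le_one_sub_agreeProb {q v : ℝ} (hq : q ∈ Set.Icc (0.13 : ℝ) 0.133) (h0 : 0 ≤ v)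
    (h1 : v ≤ 1 / 2) :
    0.766 * (1 - Real.cos (Real.pi * v)) ≤ 1 - agreeProb q v := by
  have hc : 1 - 2 * v ≤ Real.cos (Real.pi * v) := by
    have := Real.one_sub_mul_le_cos (x := Real.pi * v) (by positivity)
      (by nlinarith [Real.pi_pos])
    have e : 2 / Real.pi * (Real.pi * v) = 2 * v := by field_simp
    rwa [e] at this
  have h : 0 ≤ (q - 0.13) * ((1 - v) ^ 2 * v) :=
    mul_nonneg (by linarith [hq.1]) (by positivity)
  unfold agreeProb
  have hp : 0 ≤ v * (1 / 2 - v) := mul_nonneg h0 (by linarith)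
  nlinarith [mul_nonneg hp h0]

/-- Since `agreeProb q v = (1 - v)² (1 - q v)` decreases in `q`, the worst case is `q = 0.133`. A
Taylor bound settles acute angles, the chord of the cosine obtuse ones. -/
theorem line_le_agreeProb {q v : ℝ} (hq : q ∈ Set.Icc (0.13 : ℝ) 0.133) (h0 : 0 ≤ v)
    (h1 : v ≤ 1) :
    0.17 + 0.46 * Real.cos (Real.pi * v) ≤ agreeProb q v := by
  have h : 0 ≤ (0.133 - q) * ((1 - v) ^ 2 * v) :=
    mul_nonneg (by linarith [hq.2]) (by positivity)
  have hp : 0.867 * (1 - v) ^ 2 + 0.133 * (1 - v) ^ 3 ≤ agreeProb q v := by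
    unfold agreeProb; nlinarith
  refine le_trans ?_ hp
  rcases le_total v (1 / 2) with hv | hv
  · have hc := cos_le_taylor_four (x := Real.pi * v) (by positivity)
    have a1 : (9.8696 : ℝ) ≤ Real.pi ^ 2 := by nlinarith [Real.pi_gt_d6]
    have a2 : Real.pi ^ 2 ≤ 9.8697 := by nlinarith [Real.pi_lt_d6, Real.pi_pos]
    have a3 : Real.pi ^ 4 ≤ 97.411 := by
      have : Real.pi ^ 4 = (Real.pi ^ 2) ^ 2 := by ring
      nlinarith
    have hc' : Real.cos (Real.pi * v) ≤ 1 - 4.9348 * v ^ 2 + 4.0588 * v ^ 4 := by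
      rw [mul_pow, mul_pow] at hc
      nlinarith [sq_nonneg v, pow_nonneg h0 4, mul_nonneg (sub_nonneg.2 a1) (sq_nonneg v),
        mul_nonneg (sub_nonneg.2 a3) (pow_nonneg h0 4)]
    have hQ : 0 ≤ 2.73 - 1.47 * v - 1.87 * v ^ 2 := by nlinarith
    -- The polynomial difference has its minimum near `0.357`; `hQ` is the cofactor of the
    -- corresponding square.
    nlinarith [mul_nonneg (sq_nonneg (v - 0.357)) hQ, pow_nonneg h0 3, pow_nonneg h0 4,
      pow_nonneg h0 2]
  · have hc : Real.cos (Real.pi * v) ≤ 1 - 2 * v := by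
      have := Real.mul_le_sin (x := Real.pi * v - Real.pi / 2)
        (by nlinarith [Real.pi_pos]) (by nlinarith [Real.pi_pos])
      rw [Real.sin_sub_pi_div_two] at this
      have e : 2 / Real.pi * (Real.pi * v - Real.pi / 2) = 2 * v - 1 := by field_simp
      rw [e] at this
      linarith
    nlinarith [sq_nonneg (1 - v - 0.4), mul_nonneg (sub_nonneg.2 h1) (sq_nonneg (1 - v))]

/-- The critical inequality for the constant 0.766: at `q = 0.133` the two sides differ by little
more than `10⁻⁴` near `v = 0.2275`, hence the degree eight Taylor bound and the precise powers of
`π`. Obtuse angles are trivial by sign. -/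
theorem cos_le_agreeProb {q v : ℝ} (hq : q ∈ Set.Icc (0.13 : ℝ) 0.133) (h0 : 0 ≤ v)
    (h1 : v ≤ 1) :
    0.766 * Real.cos (Real.pi * v) ≤ agreeProb q v := by
  rcases le_total v (1 / 2) with hv | hv
  · have h : 0 ≤ (0.133 - q) * ((1 - v) ^ 2 * v) :=
      mul_nonneg (by linarith [hq.2]) (by positivity)
    have hp : 0.867 * (1 - v) ^ 2 + 0.133 * (1 - v) ^ 3 ≤ agreeProb q v := by
      unfold agreeProb; nlinarith
    refine le_trans ?_ hp
    have hc := cos_le_taylor_eight (x := Real.pi * v) (by positivity)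
    have a1 : (9.869604 : ℝ) ≤ Real.pi ^ 2 := by nlinarith [Real.pi_gt_d20]
    have a2 : Real.pi ^ 2 ≤ 9.869605 := by nlinarith [Real.pi_lt_d20, Real.pi_pos]
    have a4 : Real.pi ^ 4 ≤ 97.409112 := by
      have : Real.pi ^ 4 = (Real.pi ^ 2) ^ 2 := by ring
      nlinarith
    have a6 : (961.38864 : ℝ) ≤ Real.pi ^ 6 := by
      have : Real.pi ^ 6 = (Real.pi ^ 2) ^ 3 := by ring
      rw [this]
      exact le_trans (by norm_num) (pow_le_pow_left₀ (by norm_num) a1 3)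
    have a8 : Real.pi ^ 8 ≤ 9488.6 := by
      have : Real.pi ^ 8 = (Real.pi ^ 4) ^ 2 := by ring
      rw [this]
      exact le_trans (pow_le_pow_left₀ (by positivity) a4 2) (by norm_num)
    have hc' : Real.cos (Real.pi * v) ≤
        1 - 4.934802 * v ^ 2 + 4.058713 * v ^ 4 - 1.335262 * v ^ 6 + 0.235333 * v ^ 8 := by
      simp only [mul_pow] at hc
      linarith [mul_le_mul_of_nonneg_right a1 (pow_nonneg h0 2),
        mul_le_mul_of_nonneg_right a4 (pow_nonneg h0 4),
        mul_le_mul_of_nonneg_right a6 (pow_nonneg h0 6),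
        mul_le_mul_of_nonneg_right a8 (pow_nonneg h0 8),
        pow_nonneg h0 2, pow_nonneg h0 4, pow_nonneg h0 6, pow_nonneg h0 8]
    have b3 := pow_nonneg h0 3
    have b6 : v ^ 6 ≤ (1 / 2) ^ 6 := pow_le_pow_left₀ h0 hv 6
    have b5 : v ^ 5 ≤ (1 / 2) ^ 5 := pow_le_pow_left₀ h0 hv 5
    have b2 : v ^ 2 ≤ (1 / 2) ^ 2 := pow_le_pow_left₀ h0 hv 2
    have hQ : 0 ≤ (4.5163 - 1.5001 * v - 2.9526 * v ^ 2 + 0.4568 * v ^ 3 + 0.9948 * v ^ 4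
        - 0.0821 * v ^ 5 - 0.1803 * v ^ 6) := by
      have := pow_nonneg h0 4
      norm_num at b2 b5 b6
      linarith
    -- Near-tangency at `0.2275`: the difference is this square times its cofactor, plus a small
    -- remainder.
    have := mul_nonneg (sq_nonneg (v - 0.2275)) hQ
    have e : 0.867 * (1 - v) ^ 2 + 0.133 * (1 - v) ^ 3 - 0.766 *
        (1 - 4.934802 * v ^ 2 + 4.058713 * v ^ 4 - 1.335262 * v ^ 6 + 0.235333 * v ^ 8) ≥ 0 := by
      norm_num at this b2 b5 b6 ⊢
      linarith [pow_nonneg h0 2, pow_nonneg h0 4, pow_nonneg h0 5, pow_nonneg h0 6,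
        pow_nonneg h0 7, pow_nonneg h0 8, b3]
    linarith
  · have : Real.cos (Real.pi * v) ≤ 0 :=
      Real.cos_nonpos_of_pi_div_two_le_of_le (by nlinarith [Real.pi_pos])
        (by nlinarith [Real.pi_pos])
    linarith [agreeProb_nonneg hq h1]

/-! ### Planar Gaussian cones and Sheppard's formula -/

/-- The standard Gaussian measure of a cone in the plane, up to a constant, is its angle. -/
theorem gaussian_cone_eq_const_mul : ∃ K : ENNReal, ∀ A : Set (ℝ × ℝ), MeasurableSet A →
    (∀ r x y : ℝ, 0 < r → ((r * x, r * y) ∈ A ↔ (x, y) ∈ A)) →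
    ((gaussianReal 0 1).prod (gaussianReal 0 1)) A =
      K * volume ({φ : ℝ | (Real.cos φ, Real.sin φ) ∈ A} ∩ Set.Ioo (-Real.pi) Real.pi) := by
  refine ⟨∫⁻ r in Set.Ioi (0 : ℝ), ENNReal.ofReal r *
    ENNReal.ofReal ((2 * Real.pi)⁻¹ * Real.exp (-(r ^ 2) / 2)), fun A hA hcone => ?_⟩
  have hB : MeasurableSet {φ : ℝ | (Real.cos φ, Real.sin φ) ∈ A} :=
    (Real.measurable_cos.prodMk Real.measurable_sin) hA
  rw [gaussianReal_of_var_ne_zero 0 one_ne_zero,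
    prod_withDensity (measurable_gaussianPDF 0 1) (measurable_gaussianPDF 0 1),
    withDensity_apply _ hA, ← lintegral_indicator hA, ← Measure.volume_eq_prod,
    ← lintegral_comp_polarCoord_symm]
  -- In polar coordinates the density depends on the radius only and the cone on the angle only, so
  -- the integral factors.
  have key : ∀ p ∈ polarCoord.target, ENNReal.ofReal p.1 • A.indicator
      (fun z : ℝ × ℝ => gaussianPDF 0 1 z.1 * gaussianPDF 0 1 z.2) (polarCoord.symm p) =
      (ENNReal.ofReal p.1 * ENNReal.ofReal ((2 * Real.pi)⁻¹ * Real.exp (-(p.1 ^ 2) / 2))) *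
        {φ : ℝ | (Real.cos φ, Real.sin φ) ∈ A}.indicator 1 p.2 := by
    rintro ⟨r, φ⟩ hp
    have hr : 0 < r := hp.1
    have hmem := hcone r (Real.cos φ) (Real.sin φ) hr
    by_cases h : (Real.cos φ, Real.sin φ) ∈ A
    · rw [polarCoord_symm_apply, Set.indicator_of_mem (hmem.2 h),
        Set.indicator_of_mem (show φ ∈ {φ : ℝ | (Real.cos φ, Real.sin φ) ∈ A} from h)]
      simp only [gaussianPDF, gaussianPDFReal, Pi.one_apply, mul_one, smul_eq_mul]
      rw [← ENNReal.ofReal_mul (by positivity)]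
      congr 2
      simp only [NNReal.coe_one, mul_one, sub_zero]
      have hs : (√(2 * Real.pi))⁻¹ * (√(2 * Real.pi))⁻¹ = (2 * Real.pi)⁻¹ := by
        rw [← mul_inv, Real.mul_self_sqrt (by positivity)]
      have he : Real.exp (-(r * Real.cos φ) ^ 2 / 2) * Real.exp (-(r * Real.sin φ) ^ 2 / 2) =
          Real.exp (-(r ^ 2) / 2) := by
        rw [← Real.exp_add]
        congr 1
        have := Real.sin_sq_add_cos_sq φ
        linear_combination (-(r ^ 2) / 2) * this
      rw [← hs, ← he]
      ring
    · rw [polarCoord_symm_apply, Set.indicator_of_notMem (fun h' => h (hmem.1 h')),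
        Set.indicator_of_notMem (show φ ∉ {φ : ℝ | (Real.cos φ, Real.sin φ) ∈ A} from h)]
      simp
  rw [setLIntegral_congr_fun polarCoord.open_target.measurableSet key, polarCoord_target,
    Measure.volume_eq_prod, ← Measure.prod_restrict,
    lintegral_prod_mul (f := fun r : ℝ => ENNReal.ofReal r *
        ENNReal.ofReal ((2 * Real.pi)⁻¹ * Real.exp (-(r ^ 2) / 2)))
      (g := {φ : ℝ | (Real.cos φ, Real.sin φ) ∈ A}.indicator 1)
      (by fun_prop) ((measurable_one.indicator hB).aemeasurable),
    lintegral_indicator_one hB, Measure.restrict_apply hB]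

/-- The standard Gaussian measure of a cone in the plane is its angle over `2π`. -/
theorem gaussian_cone (A : Set (ℝ × ℝ)) (hA : MeasurableSet A)
    (hcone : ∀ r x y : ℝ, 0 < r → ((r * x, r * y) ∈ A ↔ (x, y) ∈ A)) :
    ((gaussianReal 0 1).prod (gaussianReal 0 1)).real A =
      volume.real ({φ : ℝ | (Real.cos φ, Real.sin φ) ∈ A} ∩ Set.Ioo (-Real.pi) Real.pi) /
        (2 * Real.pi) := by
  obtain ⟨K, hK⟩ := gaussian_cone_eq_const_mul
  -- The whole plane is a cone of mass one, which determines the constant.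
  have h1 := hK Set.univ MeasurableSet.univ (by simp)
  have hA := hK A hA hcone
  simp only [measure_univ, Set.mem_univ, Set.ofPred_true, Set.univ_inter, Real.volume_Ioo] at h1
  have hK' : K.toReal * (2 * Real.pi) = 1 := by
    have := congrArg ENNReal.toReal h1
    rw [ENNReal.toReal_mul, ENNReal.toReal_ofReal (by linarith [Real.pi_pos])] at this
    simp only [ENNReal.toReal_one] at this
    linarith
  rw [measureReal_def, hA, ENNReal.toReal_mul, ← measureReal_def, eq_div_iff (by positivity)]
  linear_combination (volume.real
    ({φ : ℝ | (Real.cos φ, Real.sin φ) ∈ A} ∩ Set.Ioo (-Real.pi) Real.pi)) * hK'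

theorem same_sign_cos_of_abs_lt {h φ : ℝ} (h0 : 0 ≤ h) (hφ : |φ| < Real.pi / 2 - h) :
    (0 ≤ Real.cos (φ - h) ↔ 0 ≤ Real.cos (φ + h)) := by
  obtain ⟨a, b⟩ := abs_lt.1 hφ
  exact iff_of_true (Real.cos_nonneg_of_mem_Icc ⟨by linarith, by linarith⟩)
    (Real.cos_nonneg_of_mem_Icc ⟨by linarith, by linarith⟩)

theorem same_sign_cos_of_lt {h φ : ℝ} (h0 : 0 ≤ h) (hφ : Real.pi / 2 + h < |φ|)
    (hφ' : |φ| < Real.pi) : (0 ≤ Real.cos (φ - h) ↔ 0 ≤ Real.cos (φ + h)) := by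
  have aux : ∀ x, Real.pi / 2 + h < x → x < Real.pi →
      Real.cos (x - h) < 0 ∧ Real.cos (x + h) < 0 := fun x h1 h2 =>
    ⟨Real.cos_neg_of_pi_div_two_lt_of_lt (by linarith) (by linarith),
      Real.cos_neg_of_pi_div_two_lt_of_lt (by linarith) (by linarith)⟩
  rcases abs_cases φ with ⟨e, _⟩ | ⟨e, _⟩
  · rw [e] at hφ hφ'
    obtain ⟨a, b⟩ := aux _ hφ hφ'
    exact iff_of_false a.not_ge b.not_ge
  · rw [e] at hφ hφ'
    obtain ⟨a, b⟩ := aux _ hφ hφ'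
    rw [← Real.cos_neg, show -(-φ - h) = φ + h by ring] at a
    rw [← Real.cos_neg, show -(-φ + h) = φ - h by ring] at b
    exact iff_of_false b.not_ge a.not_ge

theorem not_same_sign_cos {h φ : ℝ} (h0 : h ≤ Real.pi / 2)
    (h1 : Real.pi / 2 - h < |φ|) (h2 : |φ| < Real.pi / 2 + h) :
    ¬ (0 ≤ Real.cos (φ - h) ↔ 0 ≤ Real.cos (φ + h)) := by
  have aux : ∀ x, Real.pi / 2 - h < x → x < Real.pi / 2 + h →
      0 ≤ Real.cos (x - h) ∧ Real.cos (x + h) < 0 := fun x h1 h2 =>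
    ⟨Real.cos_nonneg_of_mem_Icc ⟨by linarith, by linarith⟩,
      Real.cos_neg_of_pi_div_two_lt_of_lt (by linarith) (by linarith)⟩
  rcases abs_cases φ with ⟨e, _⟩ | ⟨e, _⟩
  · rw [e] at h1 h2
    obtain ⟨a, b⟩ := aux _ h1 h2
    exact fun h => b.not_ge (h.1 a)
  · rw [e] at h1 h2
    obtain ⟨a, b⟩ := aux _ h1 h2
    rw [← Real.cos_neg, show -(-φ - h) = φ + h by ring] at a
    rw [← Real.cos_neg, show -(-φ + h) = φ - h by ring] at b
    exact fun h => b.not_ge (h.2 a)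

/-- Up to endpoints the signs disagree exactly when `|φ|` is within `h` of `π/2`: two intervals of
length `2h`. -/
theorem volume_same_sign_cos {h : ℝ} (h0 : 0 ≤ h) (h1 : h ≤ Real.pi / 2) :
    volume.real ({φ : ℝ | 0 ≤ Real.cos (φ - h) ↔ 0 ≤ Real.cos (φ + h)} ∩
      Set.Ioo (-Real.pi) Real.pi) = 2 * Real.pi - 4 * h := by
  have hpi := Real.pi_pos
  set S := {φ : ℝ | 0 ≤ Real.cos (φ - h) ↔ 0 ≤ Real.cos (φ + h)} ∩ Set.Ioo (-Real.pi) Real.pi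
  have hfin : volume S ≠ ⊤ := measure_ne_top_of_subset Set.inter_subset_right (by simp)
  apply le_antisymm
  · have hsub : S ⊆ Set.Icc (-(Real.pi / 2 - h)) (Real.pi / 2 - h) ∪
        (Set.Icc (Real.pi / 2 + h) Real.pi ∪ Set.Icc (-Real.pi) (-(Real.pi / 2 + h))) := by
      rintro φ ⟨hφ, hl, hr⟩
      by_cases a : |φ| ≤ Real.pi / 2 - h
      · exact Or.inl (abs_le.1 a)
      by_cases b : Real.pi / 2 + h ≤ |φ|
      · rcases le_abs.1 b with b | b
        · exact Or.inr (Or.inl ⟨b, hr.le⟩)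
        · exact Or.inr (Or.inr ⟨hl.le, by linarith⟩)
      · exact absurd hφ (not_same_sign_cos h1 (not_le.1 a) (not_le.1 b))
    calc volume.real S ≤ _ := measureReal_mono hsub
          (measure_union_ne_top measure_Icc_lt_top.ne
            (measure_union_ne_top measure_Icc_lt_top.ne measure_Icc_lt_top.ne))
      _ ≤ _ := (measureReal_union_le _ _).trans
        (add_le_add_right (measureReal_union_le _ _) _)
      _ = _ := by
        rw [Real.volume_real_Icc_of_le (by linarith), Real.volume_real_Icc_of_le (by linarith),
          Real.volume_real_Icc_of_le (by linarith)]
        ring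
  · have hsub : Set.Ioo (-(Real.pi / 2 - h)) (Real.pi / 2 - h) ∪
        (Set.Ioo (Real.pi / 2 + h) Real.pi ∪ Set.Ioo (-Real.pi) (-(Real.pi / 2 + h))) ⊆ S := by
      rintro φ (⟨a, b⟩ | ⟨a, b⟩ | ⟨a, b⟩)
      · exact ⟨same_sign_cos_of_abs_lt h0 (abs_lt.2 ⟨a, b⟩), by linarith, by linarith⟩
      · have e : |φ| = φ := abs_of_pos (by linarith)
        exact ⟨same_sign_cos_of_lt h0 (by rwa [e]) (by rwa [e]), by linarith, by linarith⟩
      · have e : |φ| = -φ := abs_of_neg (by linarith)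
        exact ⟨same_sign_cos_of_lt h0 (by rw [e]; linarith) (by rw [e]; linarith),
          by linarith, by linarith⟩
    calc 2 * Real.pi - 4 * h = volume.real (Set.Ioo (-(Real.pi / 2 - h)) (Real.pi / 2 - h) ∪
        (Set.Ioo (Real.pi / 2 + h) Real.pi ∪ Set.Ioo (-Real.pi) (-(Real.pi / 2 + h)))) := by
          rw [measureReal_union _ (measurableSet_Ioo.union measurableSet_Ioo)
              measure_Ioo_lt_top.ne (measure_union_ne_top measure_Ioo_lt_top.ne
                measure_Ioo_lt_top.ne),
            measureReal_union _ measurableSet_Ioo measure_Ioo_lt_top.ne measure_Ioo_lt_top.ne,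
            Real.volume_real_Ioo_of_le (by linarith), Real.volume_real_Ioo_of_le (by linarith),
            Real.volume_real_Ioo_of_le (by linarith)]
          · ring
          · rw [Set.disjoint_left]
            rintro x ⟨a, b⟩ ⟨c, d⟩
            linarith
          · rw [Set.disjoint_left]
            rintro x ⟨a, b⟩ (⟨c, d⟩ | ⟨c, d⟩) <;> linarith
      _ ≤ _ := measureReal_mono hsub hfin

/-- Sheppard's formula: the probability that two standard Gaussian variables with correlation
`ρ` have the same sign. -/
theorem prob_same_sign {Ω : Type*} [MeasurableSpace Ω] {μ : Measure Ω} [IsProbabilityMeasure μ]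
    {U W : Ω → ℝ} (hU : Measurable U) (hW : Measurable W) {ρ : ℝ} (hρ : ρ ∈ Set.Icc (-1 : ℝ) 1)
    (hchar : ∀ s t : ℝ, ∫ ω, Complex.exp (((s * U ω + t * W ω : ℝ) : ℂ) * Complex.I) ∂μ =
      Complex.exp ((-(s ^ 2 + 2 * ρ * s * t + t ^ 2) / 2 : ℝ) : ℂ)) :
    μ.real {ω | 0 ≤ U ω ↔ 0 ≤ W ω} = 1 - Real.arccos ρ / Real.pi := by
  set h := Real.arccos ρ / 2 with hh
  have h0 : 0 ≤ h := by have := Real.arccos_nonneg ρ; positivity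
  have h1 : h ≤ Real.pi / 2 := by have := Real.arccos_le_pi ρ; linarith
  have hcos : Real.cos h ^ 2 - Real.sin h ^ 2 = ρ := by
    rw [← Real.cos_two_mul', hh, mul_div_cancel₀ _ two_ne_zero, Real.cos_arccos hρ.1 hρ.2]
  have hone := Real.sin_sq_add_cos_sq h
  -- A standard pair is projected on two unit vectors at angles `±h`, whose inner product is `cos 2h
  -- = ρ`. This realises every correlation, the degenerate `ρ = ±1` included; characteristic
  -- functions identify the laws.
  set F : ℝ × ℝ → ℝ × ℝ := fun p =>
    (Real.cos h * p.1 + Real.sin h * p.2, Real.cos h * p.1 - Real.sin h * p.2) with hF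
  have hFm : Measurable F := by fun_prop
  have hlaw : μ.map (fun ω => (U ω, W ω)) =
      ((gaussianReal 0 1).prod (gaussianReal 0 1)).map F := by
    have : IsProbabilityMeasure (μ.map (fun ω => (U ω, W ω))) :=
      Measure.isProbabilityMeasure_map (by fun_prop)
    have : IsProbabilityMeasure (((gaussianReal 0 1).prod (gaussianReal 0 1)).map F) :=
      Measure.isProbabilityMeasure_map hFm.aemeasurable
    apply Measure.ext_of_charFunDual
    ext L
    have hL : ∀ p : ℝ × ℝ, L p = L (1, 0) * p.1 + L (0, 1) * p.2 := fun p => by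
      have : p = p.1 • ((1, 0) : ℝ × ℝ) + p.2 • ((0, 1) : ℝ × ℝ) := by ext <;> simp
      conv_lhs => rw [this, map_add, map_smul, map_smul]
      simp [mul_comm]
    set s := L (1, 0)
    set t := L (0, 1)
    rw [charFunDual_apply, charFunDual_apply,
      integral_map (by fun_prop) (Measurable.aestronglyMeasurable (by fun_prop)),
      integral_map hFm.aemeasurable (Measurable.aestronglyMeasurable (by fun_prop))]
    simp only [hL]
    rw [hchar]
    have e : ∀ p : ℝ × ℝ, Complex.exp (((s * (F p).1 + t * (F p).2 : ℝ) : ℂ) * Complex.I) =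
        Complex.exp ((((s + t) * Real.cos h : ℝ) : ℂ) * p.1 * Complex.I) *
        Complex.exp ((((s - t) * Real.sin h : ℝ) : ℂ) * p.2 * Complex.I) := fun p => by
      rw [← Complex.exp_add]
      congr 1
      simp only [hF]
      push_cast
      ring
    simp only [e]
    rw [integral_prod_mul (μ := gaussianReal 0 1) (ν := gaussianReal 0 1)
      (fun x : ℝ => Complex.exp ((((s + t) * Real.cos h : ℝ) : ℂ) * x * Complex.I))
      (fun x : ℝ => Complex.exp ((((s - t) * Real.sin h : ℝ) : ℂ) * x * Complex.I)),
      ← charFun_apply_real, ← charFun_apply_real, charFun_gaussianReal, charFun_gaussianReal,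
      ← Complex.exp_add]
    congr 1
    simp only [Complex.ofReal_zero, mul_zero, zero_mul, NNReal.coe_one, Complex.ofReal_one,
      one_mul, zero_sub]
    rw [← hcos]
    norm_cast
    linear_combination (s ^ 2 + t ^ 2) / 2 * hone
  have hA : MeasurableSet {p : ℝ × ℝ | 0 ≤ p.1 ↔ 0 ≤ p.2} :=
    (measurableSet_le measurable_const measurable_fst).iff
      (measurableSet_le measurable_const measurable_snd)
  have : μ.real {ω | 0 ≤ U ω ↔ 0 ≤ W ω} =
      (μ.map (fun ω => (U ω, W ω))).real {p : ℝ × ℝ | 0 ≤ p.1 ↔ 0 ≤ p.2} := by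
    rw [map_measureReal_apply (by fun_prop) hA]; rfl
  rw [this, hlaw, map_measureReal_apply hFm hA, gaussian_cone _ (hFm hA)]
  · have e : {φ : ℝ | (Real.cos φ, Real.sin φ) ∈ F ⁻¹' {p : ℝ × ℝ | 0 ≤ p.1 ↔ 0 ≤ p.2}} =
        {φ : ℝ | 0 ≤ Real.cos (φ - h) ↔ 0 ≤ Real.cos (φ + h)} := by
      ext φ
      simp only [Set.mem_preimage, Set.mem_ofPred_eq, hF, Real.cos_sub, Real.cos_add]
      rw [mul_comm (Real.cos φ), mul_comm (Real.sin φ)]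
    rw [e, volume_same_sign_cos h0 h1, hh]
    field_simp
    ring
  · intro r x y hr
    simp only [Set.mem_preimage, Set.mem_ofPred_eq, hF]
    have e1 : Real.cos h * (r * x) + Real.sin h * (r * y) =
        r * (Real.cos h * x + Real.sin h * y) := by ring
    have e2 : Real.cos h * (r * x) - Real.sin h * (r * y) =
        r * (Real.cos h * x - Real.sin h * y) := by ring
    rw [e1, e2, mul_nonneg_iff_of_pos_left hr, mul_nonneg_iff_of_pos_left hr]

/-! ### Corrected samples and their sign statistics -/

section Sampling

variable {V : Type*}

theorem Instance.err_nonneg (G : Instance V) (X : Matrix V V ℝ) : 0 ≤ G.err X := le_max_left _ _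

theorem Instance.neg_le_err [Finite V] (G : Instance V) (X : Matrix V V ℝ) {i j : V}
    (h : G.edges.Adj i j) : -X i j ≤ G.err X :=
  (le_ciSup (f := fun e : {p : V × V // G.edges.Adj p.1 p.2} => -X e.1.1 e.1.2)
    (Set.finite_range _).bddAbove ⟨(i, j), h⟩).trans (le_max_right _ _)

theorem Instance.err_le (G : Instance V) {X : Matrix V V ℝ} {ε : ℝ} (hε : 0 ≤ ε)
    (h : ∀ i j, G.edges.Adj i j → -ε ≤ X i j) : G.err X ≤ ε :=
  max_le hε (Real.iSup_le (fun e => by linarith [h _ _ e.2]) hε)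

theorem le_maxDiag [Finite V] (X : Matrix V V ℝ) (i : V) : X i i ≤ maxDiag X :=
  le_ciSup (f := fun i => X i i) (Set.finite_range _).bddAbove i

/-- The covariance of the corrected samples. -/
noncomputable def Instance.sampleCov [DecidableEq V] (G : Instance V) (X : Matrix V V ℝ) : Matrix V V ℝ :=
  (maxDiag X + G.err X)⁻¹ • (X + G.err X • Matrix.vecMulVec 1 1) + G.correctionCov X

theorem Instance.sampleCov_apply_self [DecidableEq V] (G : Instance V) (X : Matrix V V ℝ) (i : V) : G.sampleCov X i i = 1 := by
  simp [sampleCov, correctionCov]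
  ring

theorem Instance.sampleCov_apply_ne [DecidableEq V] (G : Instance V) {X : Matrix V V ℝ} {i j : V} (h : i ≠ j) :
    G.sampleCov X i j = (X i j + G.err X) / (maxDiag X + G.err X) := by
  simp [sampleCov, correctionCov, h]
  ring

theorem Instance.measurable_feasibleSample (G : Instance V) (X : Matrix V V ℝ) (i : V) :
    Measurable (fun s => G.feasibleSample X s i) := by
  unfold Instance.feasibleSample
  simp only [PiLp.add_apply, PiLp.smul_apply]
  fun_prop

theorem measurableSet_forall_lt {α : Type*} [MeasurableSpace α] {A : Set α}
    (hA : MeasurableSet A) :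
    MeasurableSet {ω : ℕ × (Fin 3 → α) | ∀ l : Fin 3, (l : ℕ) < ω.1 → ω.2 l ∈ A} := by
  have : {ω : ℕ × (Fin 3 → α) | ∀ l : Fin 3, (l : ℕ) < ω.1 → ω.2 l ∈ A} =
      ⋂ l : Fin 3, ((Prod.fst ⁻¹' {n | (l : ℕ) < n})ᶜ ∪ (fun ω : ℕ × (Fin 3 → α) => ω.2 l) ⁻¹' A) := by
    ext ω
    simp [imp_iff_not_or]
  rw [this]
  exact MeasurableSet.iInter fun l =>
    (measurable_fst (MeasurableSet.of_discrete)).compl.union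
      (((measurable_pi_apply l).comp measurable_snd) hA)

theorem Instance.measurableSet_clustering (G : Instance V) (X : Matrix V V ℝ) (i j : V) :
    MeasurableSet {ω | G.clustering X ω i j} :=
  measurableSet_forall_lt (A := {s | 0 ≤ G.feasibleSample X s i ↔ 0 ≤ G.feasibleSample X s j})
    ((measurableSet_le measurable_const (G.measurable_feasibleSample X i)).iff
      (measurableSet_le measurable_const (G.measurable_feasibleSample X j)))

variable [Fintype V] [DecidableEq V]

theorem Instance.correctionCov_posSemidef (G : Instance V) {X : Matrix V V ℝ}
    (hM : 0 < maxDiag X + G.err X) : (G.correctionCov X).PosSemidef := by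
  have : G.correctionCov X =
      Matrix.diagonal (fun i => 1 - (X i i + G.err X) / (maxDiag X + G.err X)) := by
    rw [correctionCov, ← Matrix.diagonal_one, Matrix.diagonal_sub]
  rw [this]
  refine Matrix.PosSemidef.diagonal fun i => ?_
  rw [Pi.zero_apply, sub_nonneg, div_le_one hM]
  linarith [le_maxDiag X i]

theorem Instance.sampleCov_posSemidef (G : Instance V) {X : Matrix V V ℝ} (hX : X.PosSemidef)
    (hM : 0 < maxDiag X + G.err X) : (G.sampleCov X).PosSemidef := by
  refine ((hX.add (Matrix.PosSemidef.smul ?_ (G.err_nonneg X))).smul (by positivity)).add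
    (G.correctionCov_posSemidef hM)
  simpa using Matrix.posSemidef_vecMulVec_self_star (1 : V → ℝ)

theorem quadForm_single_add_single {S : Matrix V V ℝ} (hS : S.PosSemidef) (i j : V) (s t : ℝ) :
    (Pi.single i s + Pi.single j t) ⬝ᵥ (S.mulVec (Pi.single i s + Pi.single j t)) =
      s ^ 2 * S i i + 2 * s * t * S i j + t ^ 2 * S j j := by
  have hsymm : S j i = S i j := by simpa using hS.isHermitian.apply i j
  simp [Matrix.mulVec_add, add_dotProduct, dotProduct_add, Matrix.mulVec_single,
    single_dotProduct, hsymm]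
  ring

theorem abs_apply_le_one {S : Matrix V V ℝ} (hS : S.PosSemidef) (hd : ∀ i, S i i = 1) (i j : V) :
    S i j ∈ Set.Icc (-1 : ℝ) 1 := by
  have h1 := hS.dotProduct_mulVec_nonneg (Pi.single i 1 + Pi.single j 1)
  have h2 := hS.dotProduct_mulVec_nonneg (Pi.single i 1 + Pi.single j (-1))
  rw [star_trivial, quadForm_single_add_single hS, hd, hd] at h1 h2
  constructor <;> linarith

theorem integral_exp_multivariateGaussian {S : Matrix V V ℝ} (hS : S.PosSemidef) (i j : V)
    (s t : ℝ) :
    ∫ x, Complex.exp (((s * x i + t * x j : ℝ) : ℂ) * Complex.I) ∂(multivariateGaussian 0 S) =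
      Complex.exp ((-(s ^ 2 * S i i + 2 * s * t * S i j + t ^ 2 * S j j) / 2 : ℝ) : ℂ) := by
  have h := charFun_multivariateGaussian (μ := 0) hS
    (EuclideanSpace.single i s + EuclideanSpace.single j t)
  rw [charFun_apply] at h
  convert h using 1
  · congr 1
    ext x
    congr 3
    rw [inner_add_right, EuclideanSpace.inner_single_right, EuclideanSpace.inner_single_right]
    simp
  · have e := quadForm_single_add_single hS i j s t
    congr 1
    simp only [inner_zero_right, WithLp.ofLp_add, PiLp.ofLp_single]
    rw [e]
    push_cast
    ring

instance (G : Instance V) (X : Matrix V V ℝ) : IsProbabilityMeasure (G.sampleLaw X) := by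
  unfold Instance.sampleLaw; infer_instance

/-- By independence the characteristic function of the pair splits into three Gaussian factors,
whose covariances add up to `sampleCov`. The correction is diagonal, so for distinct vertices it
restores unit variance without touching the correlation. -/
theorem Instance.prob_feasibleSample_same_sign (G : Instance V) {X : Matrix V V ℝ}
    (hX : X.PosSemidef) (hM : 0 < maxDiag X + G.err X) {i j : V} (hij : i ≠ j) :
    (G.sampleLaw X).real {s | 0 ≤ G.feasibleSample X s i ↔ 0 ≤ G.feasibleSample X s j} =
      1 - Real.arccos (G.sampleCov X i j) / Real.pi := by
  refine prob_same_sign (G.measurable_feasibleSample X i) (G.measurable_feasibleSample X j)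
    (abs_apply_le_one (G.sampleCov_posSemidef hX hM) (G.sampleCov_apply_self X) i j)
    fun s t => ?_
  set M := maxDiag X + G.err X with hMdef
  set r := (Real.sqrt M)⁻¹ with hr
  have hr2 : r ^ 2 = M⁻¹ := by rw [hr, inv_pow, Real.sq_sqrt hM.le]
  have he2 := Real.sq_sqrt (G.err_nonneg X)
  have e : ∀ ω : EuclideanSpace ℝ V × ℝ × EuclideanSpace ℝ V,
      Complex.exp (((s * G.feasibleSample X ω i + t * G.feasibleSample X ω j : ℝ) : ℂ)
        * Complex.I) =
      Complex.exp ((((r * s) * ω.1 i + (r * t) * ω.1 j : ℝ) : ℂ) * Complex.I) *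
        (Complex.exp (((r * √(G.err X) * (s + t) : ℝ) : ℂ) * ω.2.1 * Complex.I) *
        Complex.exp (((s * ω.2.2 i + t * ω.2.2 j : ℝ) : ℂ) * Complex.I)) := fun ω => by
    rw [← Complex.exp_add, ← Complex.exp_add]
    congr 1
    simp only [Instance.feasibleSample, PiLp.add_apply, PiLp.smul_apply, smul_eq_mul,
      ← hMdef, ← hr]
    push_cast
    ring
  simp only [e]
  unfold Instance.sampleLaw
  rw [integral_prod_mul (μ := multivariateGaussian 0 X)
    (fun x : EuclideanSpace ℝ V =>
      Complex.exp ((((r * s) * x i + (r * t) * x j : ℝ) : ℂ) * Complex.I))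
    (fun ω : ℝ × EuclideanSpace ℝ V =>
      (Complex.exp (((r * √(G.err X) * (s + t) : ℝ) : ℂ) * ω.1 * Complex.I) *
        Complex.exp (((s * ω.2 i + t * ω.2 j : ℝ) : ℂ) * Complex.I))),
    integral_prod_mul (μ := gaussianReal 0 1)
    (fun y : ℝ => Complex.exp (((r * √(G.err X) * (s + t) : ℝ) : ℂ) * y * Complex.I))
    (fun x : EuclideanSpace ℝ V => Complex.exp (((s * x i + t * x j : ℝ) : ℂ) * Complex.I)),
    integral_exp_multivariateGaussian hX,
    integral_exp_multivariateGaussian (G.correctionCov_posSemidef hM), ← charFun_apply_real,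
    charFun_gaussianReal, ← Complex.exp_add, ← Complex.exp_add]
  congr 1
  have c1 : ∀ i, G.correctionCov X i i = 1 - (X i i + G.err X) * M⁻¹ := fun i => by
    simp [correctionCov, ← hMdef, div_eq_mul_inv]
  have c2 : G.correctionCov X i j = 0 := by simp [correctionCov, hij]
  have c3 : G.sampleCov X i j = (X i j + G.err X) * M⁻¹ := by
    rw [G.sampleCov_apply_ne hij, ← hMdef, div_eq_mul_inv]
  rw [c1, c1, c2, c3, ← hr2]
  simp only [Complex.ofReal_zero, mul_zero, zero_mul, NNReal.coe_one, Complex.ofReal_one,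
    one_mul, zero_sub]
  norm_cast
  linear_combination (-(r ^ 2 * (s + t) ^ 2) / 2) * he2

theorem hyperplaneLaw_isProbabilityMeasure {q : ℝ} (hq : q ∈ Set.Icc (0 : ℝ) 1) :
    IsProbabilityMeasure (hyperplaneLaw q) := by
  constructor
  simp only [hyperplaneLaw, Measure.add_apply, Measure.smul_apply, measure_univ, smul_eq_mul,
    mul_one]
  rw [← ENNReal.ofReal_add (by linarith [hq.2]) hq.1]
  simp

theorem prob_forall_lt {α : Type*} [MeasurableSpace α] (ν : Measure α) [IsProbabilityMeasure ν]
    {q : ℝ} (hq : q ∈ Set.Icc (0 : ℝ) 1) {A : Set α} (hA : MeasurableSet A) :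
    ((hyperplaneLaw q).prod (Measure.pi fun _ : Fin 3 => ν)).real
      {ω | ∀ l : Fin 3, (l : ℕ) < ω.1 → ω.2 l ∈ A} =
      (1 - q) * ν.real A ^ 2 + q * ν.real A ^ 3 := by
  have hE := measurableSet_forall_lt hA
  -- Given `k`, the event is a box whose coordinates from `k` on are unconstrained.
  have hpi : ∀ k : ℕ, (Measure.pi fun _ : Fin 3 => ν)
      (Prod.mk k ⁻¹' {ω : ℕ × (Fin 3 → α) | ∀ l : Fin 3, (l : ℕ) < ω.1 → ω.2 l ∈ A}) =
      ∏ l : Fin 3, ν (if (l : ℕ) < k then A else Set.univ) := fun k => by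
    rw [← Measure.pi_pi]
    congr 1
    ext x
    simp only [Set.mem_preimage, Set.mem_ofPred_eq, Set.mem_pi, Set.mem_univ, true_imp_iff]
    refine forall_congr' fun l => ?_
    split_ifs with h <;> simp [h]
  rw [measureReal_def, hyperplaneLaw, Measure.add_prod, Measure.prod_smul_left,
    Measure.prod_smul_left, Measure.dirac_prod, Measure.dirac_prod, Measure.add_apply,
    Measure.smul_apply, Measure.smul_apply, Measure.map_apply measurable_prodMk_left hE,
    Measure.map_apply measurable_prodMk_left hE, hpi, hpi]
  simp only [Fin.prod_univ_three, measureReal_def]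
  simp
  rw [ENNReal.toReal_add (by finiteness) (by finiteness)]
  simp [ENNReal.toReal_ofReal, hq.1, sub_nonneg.2 hq.2]
  ring

theorem Instance.prob_clustering (G : Instance V) {X : Matrix V V ℝ} {q : ℝ}
    (hq : q ∈ Set.Icc (0 : ℝ) 1)
    (hX : X.PosSemidef) (hM : 0 < maxDiag X + G.err X) {i j : V} (hij : i ≠ j) :
    (G.noiseLaw q X).real {ω | G.clustering X ω i j} =
      agreeProb q (Real.arccos (G.sampleCov X i j) / Real.pi) := by
  rw [agreeProb, ← G.prob_feasibleSample_same_sign hX hM hij]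
  exact prob_forall_lt _ hq
    ((measurableSet_le measurable_const (G.measurable_feasibleSample X i)).iff
      (measurableSet_le measurable_const (G.measurable_feasibleSample X j)))

end Sampling

/-! ### Laplacian and adjacency forms -/

section Forms

variable {V : Type*}

theorem WGraph.weight_self (H : WGraph V) (i : V) : H.weight i i = 0 :=
  H.weight_eq_zero i i (H.graph.loopless.irrefl i)

variable [Fintype V]

theorem innerMat_eq_sum (A B : Matrix V V ℝ) : innerMat A B = ∑ i, ∑ j, A i j * B i j := by
  simp only [innerMat, Matrix.trace, Matrix.diag_apply, Matrix.mul_apply, Matrix.transpose_apply]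
  exact Finset.sum_comm

theorem innerMat_add_left (A B C : Matrix V V ℝ) :
    innerMat (A + B) C = innerMat A C + innerMat B C := by
  simp [innerMat, Matrix.add_mul]

theorem innerMat_adj (H : WGraph V) (Y : Matrix V V ℝ) :
    innerMat H.adj Y = ∑ i, ∑ j, H.weight i j * Y i j := by
  rw [innerMat_eq_sum]; rfl

theorem innerMat_conjTranspose_mul_self (L B : Matrix V V ℝ) :
    innerMat L (B.conjTranspose * B) = ∑ k, B k ⬝ᵥ L.mulVec (B k) := by
  rw [innerMat_eq_sum]
  simp only [Matrix.mul_apply, Matrix.conjTranspose_apply, star_trivial, Finset.mul_sum,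
    dotProduct, Matrix.mulVec]
  rw [Finset.sum_comm_cycle]
  refine Finset.sum_congr rfl fun k _ => Finset.sum_congr rfl fun i _ =>
    Finset.sum_congr rfl fun j _ => ?_
  ring

variable [DecidableEq V]

theorem innerMat_lap (H : WGraph V) (Y : Matrix V V ℝ) :
    innerMat H.lap Y = ∑ i, ∑ j, H.weight i j * (Y i i - Y i j) := by
  rw [innerMat_eq_sum]
  refine Finset.sum_congr rfl fun i _ => ?_
  simp only [WGraph.lap, Matrix.sub_apply, sub_mul, Finset.sum_sub_distrib, mul_sub,
    Matrix.diagonal_apply, ite_mul, zero_mul, Finset.sum_ite_eq, Finset.mem_univ, if_true,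
    Finset.sum_mul]
  rfl

/-- The inner product of a Laplacian with the identity is the total weight. -/
theorem innerMat_lap_one (H : WGraph V) : innerMat H.lap 1 = ∑ i, ∑ j, H.weight i j := by
  rw [innerMat_lap]
  refine Finset.sum_congr rfl fun i _ => Finset.sum_congr rfl fun j _ => ?_
  by_cases h : i = j
  · subst h; simp [H.weight_self]
  · simp [h]

/-- Makes adjacency forms, about which spectral closeness says nothing directly, accessible through
Laplacians. -/
theorem innerMat_adj_eq (H : WGraph V) {Y : Matrix V V ℝ} (hY : ∀ i, Y i i = 1) :
    innerMat H.adj Y = innerMat H.lap 1 - innerMat H.lap Y := by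
  rw [innerMat_lap_one, innerMat_lap, innerMat_adj]
  simp only [hY, ← Finset.sum_sub_distrib]
  refine Finset.sum_congr rfl fun i _ => Finset.sum_congr rfl fun j _ => ?_
  ring

theorem innerMat_cost (G : Instance V) (Y : Matrix V V ℝ) :
    innerMat G.cost Y = innerMat G.neg.lap Y + innerMat G.pos.adj Y :=
  innerMat_add_left _ _ _

open scoped MatrixOrder in
-- A positive semidefinite matrix is a Gram matrix `Bᵀ B`, so its inner product with a Laplacian is
-- a sum of quadratic forms at the rows of `B`.
theorem SpectrallyClose.innerMat_le {τ : ℝ} {H H' : WGraph V} (h : SpectrallyClose τ H H')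
    {Y : Matrix V V ℝ} (hY : Y.PosSemidef) :
    (1 - τ) * innerMat H.lap Y ≤ innerMat H'.lap Y ∧
      innerMat H'.lap Y ≤ (1 + τ) * innerMat H.lap Y := by
  obtain ⟨B, rfl⟩ : ∃ B : Matrix V V ℝ, Y = B.conjTranspose * B := by
    refine ⟨CFC.sqrt Y, ?_⟩
    have hB : (CFC.sqrt Y).conjTranspose = CFC.sqrt Y := (CFC.sqrt_nonneg Y).isSelfAdjoint
    rw [hB, CFC.sqrt_mul_sqrt_self _ hY.nonneg]
  simp only [innerMat_conjTranspose_mul_self, Finset.mul_sum]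
  exact ⟨Finset.sum_le_sum fun k _ => (h (B k)).1, Finset.sum_le_sum fun k _ => (h (B k)).2⟩

end Forms

/-! ### Clusterings as feasible 0-1 matrices -/

section Clusterings

variable {V : Type*}

open Classical in
/-- The `0`-`1` matrix of a clustering. -/
noncomputable def clusterMat (P : Setoid V) : Matrix V V ℝ :=
  Matrix.of fun i j => if P i j then 1 else 0

theorem clusterMat_self (P : Setoid V) (i : V) : clusterMat P i i = 1 := by
  simp [clusterMat]

variable [Fintype V]

theorem clusterMat_posSemidef (P : Setoid V) : (clusterMat P).PosSemidef := by
  classical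
  -- Column `i` is the indicator of the chosen representative of the cluster of `i`, so the Gram
  -- matrix of the columns is the cluster matrix.
  set B : Matrix V V ℝ := Matrix.of fun k i => if (Quotient.mk P i).out = k then 1 else 0
    with hB
  suffices h : clusterMat P = B.conjTranspose * B by
    rw [h]; exact Matrix.posSemidef_conjTranspose_mul_self B
  ext i j
  have : Quotient.mk P i = Quotient.mk P j ↔ P i j := Quotient.eq
  simp [hB, clusterMat, Matrix.mul_apply, this]

theorem Instance.value_le_opt (G : Instance V) (P : Setoid V) : G.value P ≤ G.opt := by
  have : Finite (Setoid V) :=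
    Finite.of_injective (fun P : Setoid V => P.r) fun P Q h => Setoid.ext fun a b =>
      iff_of_eq (congrFun (congrFun h a) b)
  exact le_ciSup (Set.finite_range _).bddAbove P

theorem Instance.value_nonneg (G : Instance V) (P : Setoid V) : 0 ≤ G.value P := by
  refine mul_nonneg (by norm_num) (Finset.sum_nonneg fun i _ => Finset.sum_nonneg fun j _ => ?_)
  have := G.pos.weight_nonneg i j
  have := G.neg.weight_nonneg i j
  split_ifs <;> linarith

theorem Instance.isFeasible_clusterMat (G : Instance V) (P : Setoid V) :
    G.IsFeasible (clusterMat P) where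
  posSemidef := clusterMat_posSemidef P
  diag_eq_one := clusterMat_self P
  nonneg_of_adj i j _ := by
    simp only [clusterMat, Matrix.of_apply]
    split_ifs <;> norm_num

variable [DecidableEq V]

theorem Instance.value_eq (G : Instance V) (P : Setoid V) :
    G.value P = 1 / 2 * innerMat G.cost (clusterMat P) := by
  rw [value, innerMat_cost, innerMat_lap, innerMat_adj, ← Finset.sum_add_distrib]
  congr 1
  refine Finset.sum_congr rfl fun i _ => ?_
  rw [← Finset.sum_add_distrib]
  refine Finset.sum_congr rfl fun j _ => ?_
  rw [clusterMat_self]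
  simp only [clusterMat, Matrix.of_apply]
  split_ifs <;> simp

end Clusterings

/-! ### Random clusterings and their mean matrix -/

section Random

variable {V Ω : Type*} [MeasurableSpace Ω] (μ : Measure Ω) (c : Ω → Setoid V)

/-- The matrix of the probabilities that two vertices share a cluster. -/
noncomputable def agreeMat : Matrix V V ℝ := Matrix.of fun i j => μ.real {ω | c ω i j}

theorem integrable_clusterMat [IsProbabilityMeasure μ]
    (hc : ∀ i j, MeasurableSet {ω | c ω i j}) (i j : V) :
    Integrable (fun ω => clusterMat (c ω) i j) μ := by
  have : (fun ω => clusterMat (c ω) i j) = {ω | c ω i j}.indicator 1 := by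
    ext ω; by_cases h : c ω i j <;> simp [clusterMat, h]
  rw [this]
  exact (integrable_const (1 : ℝ)).indicator (hc i j)

theorem integral_clusterMat (hc : ∀ i j, MeasurableSet {ω | c ω i j}) (i j : V) :
    ∫ ω, clusterMat (c ω) i j ∂μ = agreeMat μ c i j := by
  have : (fun ω => clusterMat (c ω) i j) = {ω | c ω i j}.indicator 1 := by
    ext ω; by_cases h : c ω i j <;> simp [clusterMat, h]
  rw [this, integral_indicator_one (hc i j)]
  rfl

theorem agreeMat_self [IsProbabilityMeasure μ] (i : V) : agreeMat μ c i i = 1 := by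
  simp [agreeMat]

variable [Fintype V]

theorem integrable_innerMat_clusterMat [IsProbabilityMeasure μ]
    (hc : ∀ i j, MeasurableSet {ω | c ω i j}) (A : Matrix V V ℝ) :
    Integrable (fun ω => innerMat A (clusterMat (c ω))) μ := by
  simp only [innerMat_eq_sum]
  exact integrable_finsetSum _ fun i _ => integrable_finsetSum _ fun j _ =>
    (integrable_clusterMat μ c hc i j).const_mul _

theorem integral_innerMat_clusterMat [IsProbabilityMeasure μ]
    (hc : ∀ i j, MeasurableSet {ω | c ω i j}) (A : Matrix V V ℝ) :
    ∫ ω, innerMat A (clusterMat (c ω)) ∂μ = innerMat A (agreeMat μ c) := by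
  simp only [innerMat_eq_sum]
  refine (integral_finsetSum _ fun i _ => integrable_finsetSum _ fun j _ =>
    (integrable_clusterMat μ c hc i j).const_mul _).trans ?_
  refine Finset.sum_congr rfl fun i _ => ?_
  refine (integral_finsetSum _ fun j _ => (integrable_clusterMat μ c hc i j).const_mul _).trans ?_
  refine Finset.sum_congr rfl fun j _ => ?_
  rw [integral_const_mul, integral_clusterMat μ c hc]

/-- It is the mean of positive semidefinite cluster matrices. This is what lets spectral closeness
act on the rounded solution. -/
theorem agreeMat_posSemidef [IsProbabilityMeasure μ]
    (hc : ∀ i j, MeasurableSet {ω | c ω i j}) : (agreeMat μ c).PosSemidef := by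
  refine Matrix.PosSemidef.of_dotProduct_mulVec_nonneg ?_ fun x => ?_
  · ext i j
    have : {ω | c ω j i} = {ω | c ω i j} := by
      ext ω; exact ⟨(c ω).symm, (c ω).symm⟩
    simp [agreeMat, this]
  · have key : ∀ Y : Matrix V V ℝ, star x ⬝ᵥ Y.mulVec x = innerMat (Matrix.vecMulVec x x) Y := by
      intro Y
      rw [innerMat_eq_sum]
      simp only [dotProduct, Matrix.mulVec, Matrix.vecMulVec_apply, Finset.mul_sum, star_trivial]
      exact Finset.sum_congr rfl fun i _ => Finset.sum_congr rfl fun j _ => by ring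
    rw [key, ← integral_innerMat_clusterMat μ c hc]
    exact integral_nonneg fun ω => by
      rw [Pi.zero_apply, ← key]
      exact (clusterMat_posSemidef (c ω)).dotProduct_mulVec_nonneg x

end Random

/-! ### The numerical trade-off between the two linear bounds -/

/-- The weight `t` cancels, and to first order in `τ` the right side exceeds the left by `2τ (1.5 S
- S' - c) + 3τ D`. This is the origin of the threshold for `c`. -/
theorem combine_bounds_small_cut {τ t S S' c D : ℝ} (hτ0 : 0 < τ) (hτ1 : τ < 1 / 9)
    (hS' : S' ≤ S) (hS : 0 ≤ S) (hS0 : 0 ≤ S') (hD0 : 0 ≤ D) (hc : c ≤ 1.5 * S - S') :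
    (1 + τ) * ((1 - τ ^ 2) * (S' - 3 * τ * S)) + (1 - 3 * τ) * D ≤
      (1 - τ) * (S' - t + c) + (D + (1 - τ) * t) - (1 + τ) * c := by
  have h3 : τ ^ 3 ≤ τ ^ 2 / 9 := by nlinarith [sq_nonneg τ]
  have h33 : 0 ≤ τ ^ 3 := by positivity
  have : 0 ≤ τ * (1.5 * S - S' - c) := mul_nonneg hτ0.le (by linarith)
  have b3 : 0 ≤ τ ^ 3 * (S - S') := mul_nonneg h33 (by linarith)
  have b4 : τ ^ 3 * S ≤ τ ^ 2 / 9 * S := mul_le_mul_of_nonneg_right h3 hS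
  have b5 : 0 ≤ τ ^ 4 * S := by positivity
  have b6 : 0 ≤ τ ^ 2 * S' := by positivity
  have b7 : 0 ≤ τ ^ 3 * S' := by positivity
  have b8 : 0 ≤ τ * D := by positivity
  nlinarith

/-- Passing to the flatter line loses `0.136 = 0.766 - 0.63` per unit of `t` and gains `0.306 =
0.766 - 0.46` per unit of `c`. Beyond the threshold `c ≥ S / 2`, and `0.153 S` exceeds `0.136 t`;
the slack pays for the terms in `τ`. -/
theorem combine_bounds_large_cut {τ t S S' c D : ℝ} (hτ0 : 0 < τ) (hτ1 : τ < 1 / 9)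
    (htS : t ≤ S) (hS' : S' ≤ S) (hS : 0 ≤ S) (hS0 : 0 ≤ S') (hD0 : 0 ≤ D)
    (hD1 : D ≤ 2 * τ * t) (hc : 1.5 * S - S' ≤ c) :
    0.766 * ((1 + τ) * ((1 - τ ^ 2) * (S' - 3 * τ * S)) + (1 - 3 * τ) * D) ≤
      0.766 * (1 - τ) * (S' - t + c) + 0.63 * (D + (1 - τ) * t) - 0.46 * (1 + τ) * c := by
  have h3 : τ ^ 3 ≤ τ ^ 2 / 9 := by nlinarith [sq_nonneg τ]
  have e : 0.766 * (1 - τ) * (S' - t + c) + 0.63 * (D + (1-τ)*t) - 0.46 * (1 + τ) * c - 0.766 * ((1 + τ) * ((1 - τ ^ 2) * (S' - 3 * τ * S)) + (1-3*τ) * D)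
     = (-0.136 + 2.298 * τ) * D - 0.136 * (1-τ) * t + (0.306 - 1.226*τ) * c + 0.766 * ((2 * τ ^2 +τ^3 -τ^2) * S' -2 * τ * S' + 3 * τ * (1+τ)*(1-τ^2) * S) := by ring
  have d1 : -0.136 * D ≥ - 0.272 * τ * t := by linarith
  have d2 : 0 ≤ 2.298 * τ * D := by positivity
  have t1 : τ * t ≤ τ * S := by nlinarith
  have t2 : (0.306 - 1.226*τ) * c ≥ (0.306 - 1.226*τ) * (1.5 * S - S') := mul_le_mul_of_nonneg_left hc (by linarith)
  have t3 : 0 ≤ (τ^2 + τ^3) * S' := by positivity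
  have t4 : 0 ≤ τ^2 * S := by positivity
  have t5 : τ^3 * S ≤ τ^2/9 * S := mul_le_mul_of_nonneg_right h3 hS
  have t6 : τ^4 * S ≤ τ^2/81 * S := mul_le_mul_of_nonneg_right (by nlinarith) hS
  have u1 : 0 ≤ (S - S') * (0.306 - 1.226 * τ + 1.532 * τ) := mul_nonneg (by linarith) (by linarith)
  have u2 : 0 ≤ (1 / 9 - τ) * S := mul_nonneg (by linarith) hS
  have u3 : 0 ≤ τ * S := by positivity
  nlinarith

/-- The numerical inequality that combines the two linear lower bounds on the probability that two
vertices share a cluster: `T`, `t` are the total positive weights before and after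
sparsification, `S` is the value of the relaxation, `S'` and `c` are the objective and the positive
cut of the feasible covariance, `E` and `O` the expected and the optimal value. -/
theorem combine_bounds {ε τ T t S S' c E O : ℝ} (hτ0 : 0 < τ) (hτ1 : τ < 1 / 9)
    (hε : 0 < ε) (hκ : 0 ≤ 1 - 6 * ε - 3 * τ)
    (hT0 : (1 - τ) * T ≤ t) (hT1 : t ≤ (1 + τ) * T) (hc0 : 0 ≤ c) (hct : c ≤ t) (htS : t ≤ S)
    (hS' : S' ≤ S) (hS6 : (1 - 6 * ε) * S ≤ S')
    (hO : (1 - τ ^ 2) * O ≤ (1 + τ) * S + (1 - τ ^ 2) * T - (1 - τ) * t)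
    (hE1 : 0.766 * (1 - τ) * (S' - t + c) + 0.766 * (1 - τ ^ 2) * T - 0.766 * (1 + τ) * c
      ≤ (1 - τ ^ 2) * E)
    (hE2 : 0.766 * (1 - τ) * (S' - t + c) + 0.63 * (1 - τ ^ 2) * T - 0.46 * (1 + τ) * c
      ≤ (1 - τ ^ 2) * E) :
    0.766 * (1 - 6 * ε - 3 * τ) * (1 - τ ^ 2) * O ≤ E := by
  have hpos : 0 < 1 - τ ^ 2 := by nlinarith
  have hS : 0 ≤ S := by linarith
  -- `D` is the discrepancy in total positive weight; spectral closeness at the identity puts it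
  -- between `0` and `2τ t`.
  set D := (1 - τ ^ 2) * T - (1 - τ) * t with hD
  have hD0 : 0 ≤ D := by rw [hD]; nlinarith
  have hD1 : D ≤ 2 * τ * t := by rw [hD]; nlinarith
  set κ := (1 - 6 * ε - 3 * τ) * (1 - τ ^ 2) with hκd
  have hκ0 : 0 ≤ κ := mul_nonneg hκ hpos.le
  have hκ1 : κ ≤ 1 - 3 * τ := by
    rw [hκd]; nlinarith [mul_nonneg hκ (sq_nonneg τ)]
  -- The `3τ` in the factor is kept as a reserve `3τ S` to pay for the additive errors.
  have hκS : κ * S ≤ (1 - τ ^ 2) * (S' - 3 * τ * S) := by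
    rw [hκd]; nlinarith
  have hκO : κ * ((1 - τ ^ 2) * O) ≤ (1 + τ) * ((1 - τ ^ 2) * (S' - 3 * τ * S)) + κ * D := by
    have := mul_le_mul_of_nonneg_left hO hκ0
    nlinarith
  have hfin : 0.766 * ((1 + τ) * ((1 - τ ^ 2) * (S' - 3 * τ * S)) + κ * D) ≤ (1 - τ ^ 2) * E := by
    have hκD : κ * D ≤ (1 - 3 * τ) * D := mul_le_mul_of_nonneg_right hκ1 hD0
    have hS0 : 0 ≤ S' := le_trans (mul_nonneg (by linarith) hS) hS6
    refine (mul_le_mul_of_nonneg_left (add_le_add_right hκD _) (by norm_num)).trans ?_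
    have hT : (1 - τ ^ 2) * T = D + (1 - τ) * t := by rw [hD]; ring
    rcases le_total c (1.5 * S - S') with hc | hc
    · refine le_trans ?_ hE1
      rw [mul_assoc (0.766 : ℝ) (1 - τ ^ 2) T, hT]
      linarith [combine_bounds_small_cut (t := t) hτ0 hτ1 hS' hS hS0 hD0 hc]
    · refine le_trans ?_ hE2
      rw [mul_assoc (0.63 : ℝ) (1 - τ ^ 2) T, hT]
      exact combine_bounds_large_cut hτ0 hτ1 htS hS' hS hS0 hD0 hD1 hc
  have : (1 - τ ^ 2) * (0.766 * (1 - 6 * ε - 3 * τ) * (1 - τ ^ 2) * O) ≤ (1 - τ ^ 2) * E := by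
    calc _ = 0.766 * (κ * ((1 - τ ^ 2) * O)) := by rw [hκd]; ring
      _ ≤ _ := (mul_le_mul_of_nonneg_left hκO (by norm_num)).trans hfin
  exact le_of_mul_le_mul_left this hpos

/-! ### Transfer between the two instances and analysis of the rounding -/

section Rounding

variable {V : Type*} [Fintype V]

theorem sum_weight_le_sum_weight (H : WGraph V) {Y Z : V → V → ℝ}
    (h : ∀ i j, H.graph.Adj i j → Y i j ≤ Z i j) :
    ∑ i, ∑ j, H.weight i j * Y i j ≤ ∑ i, ∑ j, H.weight i j * Z i j := by
  refine Finset.sum_le_sum fun i _ => Finset.sum_le_sum fun j _ => ?_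
  by_cases hij : H.graph.Adj i j
  · exact mul_le_mul_of_nonneg_left (h i j hij) (H.weight_nonneg i j)
  · simp [H.weight_eq_zero i j hij]

theorem innerMat_adj_le (H : WGraph V) {Y Z : Matrix V V ℝ}
    (h : ∀ i j, H.graph.Adj i j → Y i j ≤ Z i j) : innerMat H.adj Y ≤ innerMat H.adj Z := by
  rw [innerMat_adj, innerMat_adj]
  exact sum_weight_le_sum_weight H h

theorem innerMat_smul_right (A Y : Matrix V V ℝ) (r : ℝ) :
    innerMat A (r • Y) = r * innerMat A Y := by
  simp [innerMat]

variable [DecidableEq V]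

theorem innerMat_lap_le (H : WGraph V) {Y Z : Matrix V V ℝ}
    (h : ∀ i j, H.graph.Adj i j → Y i i - Y i j ≤ Z i i - Z i j) :
    innerMat H.lap Y ≤ innerMat H.lap Z := by
  rw [innerMat_lap, innerMat_lap]
  exact sum_weight_le_sum_weight H (Y := fun i j => Y i i - Y i j)
    (Z := fun i j => Z i i - Z i j) h

/-- The optimal value of an instance is controlled by the relaxation of a spectrally close one. -/
theorem Instance.opt_le {τ : ℝ} (hτ0 : 0 < τ) (hτ1 : τ < 1) {G Gs : Instance V}
    (hpos : SpectrallyClose τ G.pos Gs.pos) (hneg : SpectrallyClose τ G.neg Gs.neg)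
    {Xopt : Matrix V V ℝ} (hXopt : Gs.IsOptimal Xopt) :
    (1 - τ ^ 2) * (2 * G.opt) ≤ (1 + τ) * innerMat Gs.cost Xopt +
      (1 - τ ^ 2) * innerMat G.pos.lap 1 - (1 - τ) * innerMat Gs.pos.lap 1 := by
  have h2 : 0 < 1 - τ ^ 2 := by nlinarith
  have key : ∀ P : Setoid V, G.value P ≤ ((1 + τ) * innerMat Gs.cost Xopt +
      (1 - τ ^ 2) * innerMat G.pos.lap 1 - (1 - τ) * innerMat Gs.pos.lap 1) /
        (2 * (1 - τ ^ 2)) := fun P => by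
    have hP := clusterMat_posSemidef P
    have h := hXopt.2 _ (Gs.isFeasible_clusterMat P)
    have hn := (hneg.innerMat_le hP).1
    have hp := (hpos.innerMat_le hP).2
    -- The positive weight inside clusters carries the factor `1 - τ` after transfer; as it is
    -- nonnegative, this may be raised to `1 + τ` and absorbed into the relaxation value.
    have hc : 0 ≤ innerMat Gs.pos.adj (clusterMat P) := by
      have := innerMat_adj_le Gs.pos (Y := 0) (Z := clusterMat P) fun i j hij =>
        (Gs.isFeasible_clusterMat P).nonneg_of_adj i j (Or.inl hij)
      refine le_trans (le_of_eq ?_) this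
      simp [innerMat]
    rw [innerMat_adj_eq _ (clusterMat_self P)] at hc
    rw [innerMat_cost, innerMat_adj_eq _ (clusterMat_self P)] at h
    rw [Instance.value_eq, innerMat_cost, innerMat_adj_eq _ (clusterMat_self P),
      le_div_iff₀ (by linarith)]
    nlinarith
  have : G.opt ≤ _ := ciSup_le key
  rw [le_div_iff₀ (by linarith)] at this
  linarith

theorem Instance.sampleCov_nonneg (G : Instance V) {X : Matrix V V ℝ}
    (hM : 0 < maxDiag X + G.err X) {i j : V} (h : G.edges.Adj i j) : 0 ≤ G.sampleCov X i j := by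
  rw [G.sampleCov_apply_ne h.ne]
  exact div_nonneg (by linarith [G.neg_le_err X h]) hM.le

theorem Instance.isFeasible_sampleCov (G : Instance V) {X : Matrix V V ℝ} (hX : X.PosSemidef)
    (hM : 0 < maxDiag X + G.err X) : G.IsFeasible (G.sampleCov X) where
  posSemidef := G.sampleCov_posSemidef hX hM
  diag_eq_one := G.sampleCov_apply_self X
  nonneg_of_adj _ _ h := G.sampleCov_nonneg hM h

/-- After scaling, off-diagonal entries become `X i j + err` and diagonal ones `maxDiag + err`. The
shift drops out of Laplacian differences, where the larger diagonal can only help, and it increases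
adjacency terms. -/
theorem Instance.innerMat_cost_le_sampleCov (G : Instance V) {X : Matrix V V ℝ}
    (hM : 0 < maxDiag X + G.err X) :
    innerMat G.cost X ≤ (maxDiag X + G.err X) * innerMat G.cost (G.sampleCov X) := by
  have e : ∀ i j, i ≠ j → (maxDiag X + G.err X) * G.sampleCov X i j = X i j + G.err X :=
    fun i j h => by rw [G.sampleCov_apply_ne h]; field_simp
  rw [← innerMat_smul_right, innerMat_cost, innerMat_cost]
  refine add_le_add (innerMat_lap_le _ fun i j h => ?_) (innerMat_adj_le _ fun i j h => ?_)
  · simp only [Matrix.smul_apply, smul_eq_mul, e i j h.ne, G.sampleCov_apply_self]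
    linarith [le_maxDiag X i]
  · simp only [Matrix.smul_apply, smul_eq_mul, e i j h.ne]
    linarith [G.err_nonneg X]

/-- Repairing a near solution costs a factor `1 - 6 ε`. -/
theorem Instance.IsNearSolution.le_innerMat_sampleCov [Nonempty V] {G : Instance V} {ε : ℝ}
    (hε0 : 0 < ε) (hε1 : ε < 1 / 9) {Xopt X : Matrix V V ℝ} (hX : G.IsNearSolution ε Xopt X)
    (hS : 0 ≤ innerMat G.cost Xopt) :
    0 < maxDiag X + G.err X ∧
      (1 - 6 * ε) * innerMat G.cost Xopt ≤ innerMat G.cost (G.sampleCov X) := by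
  have he := G.err_le hε0.le hX.near_nonneg
  have he0 := G.err_nonneg X
  have hm : maxDiag X ≤ 1 + ε := ciSup_le fun i => by
    linarith [(abs_le.1 (hX.diag_near_one i)).2]
  obtain ⟨v⟩ := ‹Nonempty V›
  have hm0 : 1 - ε ≤ maxDiag X := by
    linarith [(abs_le.1 (hX.diag_near_one v)).1, le_maxDiag X v]
  have hM : 0 < maxDiag X + G.err X := by linarith
  refine ⟨hM, ?_⟩
  have h1 := G.innerMat_cost_le_sampleCov hM
  have h2 := hX.lower_optimal
  refine le_of_mul_le_mul_left ?_ hM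
  have h3 : (maxDiag X + G.err X) * ((1 - 6 * ε) * innerMat G.cost Xopt) ≤
      (1 + 2 * ε) * ((1 - 6 * ε) * innerMat G.cost Xopt) :=
    mul_le_mul_of_nonneg_right (by linarith) (mul_nonneg (by linarith) hS)
  -- `(1 + 2ε)(1 - 6ε) = 1 - 4ε - 12ε²` is at most `1 - 4ε`.
  nlinarith [mul_nonneg (sq_nonneg ε) hS]

theorem isProbabilityMeasure_noiseLaw (G : Instance V) (X : Matrix V V ℝ) {q : ℝ}
    (hq : q ∈ Set.Icc (0 : ℝ) 1) : IsProbabilityMeasure (G.noiseLaw q X) := by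
  have := hyperplaneLaw_isProbabilityMeasure hq
  unfold Instance.noiseLaw
  infer_instance

theorem Instance.integral_value (G Gs : Instance V) (X : Matrix V V ℝ) {q : ℝ}
    (hq : q ∈ Set.Icc (0 : ℝ) 1) :
    Integrable (fun ω => G.value (Gs.clustering X ω)) (Gs.noiseLaw q X) ∧
      ∫ ω, G.value (Gs.clustering X ω) ∂(Gs.noiseLaw q X) =
        1 / 2 * innerMat G.cost (agreeMat (Gs.noiseLaw q X) (Gs.clustering X)) := by
  have := isProbabilityMeasure_noiseLaw Gs X hq
  simp only [Instance.value_eq]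
  refine ⟨(integrable_innerMat_clusterMat _ _ (Gs.measurableSet_clustering X) _).const_mul _, ?_⟩
  rw [integral_const_mul, integral_innerMat_clusterMat _ _ (Gs.measurableSet_clustering X)]

/-- The probability that two vertices share a cluster, as a function of their correlation:
the linear bounds used below. -/
theorem Instance.agreeMat_bounds (G : Instance V) {X : Matrix V V ℝ} {q : ℝ}
    (hq : q ∈ Set.Icc (0.13 : ℝ) 0.133) (hX : X.PosSemidef) (hM : 0 < maxDiag X + G.err X)
    {i j : V} (hij : i ≠ j) :
    0.766 * G.sampleCov X i j ≤ agreeMat (G.noiseLaw q X) (G.clustering X) i j ∧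
    0.17 + 0.46 * G.sampleCov X i j ≤ agreeMat (G.noiseLaw q X) (G.clustering X) i j ∧
    (0 ≤ G.sampleCov X i j → 0.766 * (1 - G.sampleCov X i j) ≤
      1 - agreeMat (G.noiseLaw q X) (G.clustering X) i j) := by
  have hq' : q ∈ Set.Icc (0 : ℝ) 1 := ⟨by linarith [hq.1], by linarith [hq.2]⟩
  have hp : agreeMat (G.noiseLaw q X) (G.clustering X) i j =
      agreeProb q (Real.arccos (G.sampleCov X i j) / Real.pi) :=
    G.prob_clustering hq' hX hM hij
  have hR := abs_apply_le_one (G.sampleCov_posSemidef hX hM) (G.sampleCov_apply_self X) i j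
  set ρ := G.sampleCov X i j
  have hv0 : 0 ≤ Real.arccos ρ / Real.pi := div_nonneg (Real.arccos_nonneg ρ) Real.pi_pos.le
  have hv1 : Real.arccos ρ / Real.pi ≤ 1 :=
    (div_le_one Real.pi_pos).2 (Real.arccos_le_pi ρ)
  have hc : Real.cos (Real.pi * (Real.arccos ρ / Real.pi)) = ρ := by
    rw [mul_div_cancel₀ _ Real.pi_ne_zero, Real.cos_arccos hR.1 hR.2]
  have h1 := cos_le_agreeProb hq hv0 hv1
  have h2 := line_le_agreeProb hq hv0 hv1
  rw [hc, ← hp] at h1 h2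
  refine ⟨h1, h2, fun hρ => ?_⟩
  have hv2 : Real.arccos ρ / Real.pi ≤ 1 / 2 := by
    rw [div_le_div_iff₀ Real.pi_pos two_pos]
    linarith [Real.arccos_le_pi_div_two.2 hρ]
  have h3 := le_one_sub_agreeProb hq hv0 hv2
  rwa [hc, ← hp] at h3

theorem Instance.le_integral_value {ε τ q : ℝ} (hε : ε ∈ Set.Ioo (0 : ℝ) (1 / 9))
    (hτ : τ ∈ Set.Ioo (0 : ℝ) (1 / 9)) (hq : q ∈ Set.Icc (0.13 : ℝ) 0.133) [Nonempty V]
    (G Gs : Instance V) (hpos : SpectrallyClose τ G.pos Gs.pos)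
    (hneg : SpectrallyClose τ G.neg Gs.neg) (hκ : 0 ≤ 1 - 6 * ε - 3 * τ)
    {Xopt X : Matrix V V ℝ} (hXopt : Gs.IsOptimal Xopt) (hX : Gs.IsNearSolution ε Xopt X) :
    0.766 * (1 - 6 * ε - 3 * τ) * (1 - τ ^ 2) * G.opt ≤
      ∫ ω, G.value (Gs.clustering X ω) ∂(Gs.noiseLaw q X) := by
  obtain ⟨hτ0, hτ1⟩ := hτ
  have hq' : q ∈ Set.Icc (0 : ℝ) 1 := ⟨by linarith [hq.1], by linarith [hq.2]⟩
  have := isProbabilityMeasure_noiseLaw Gs X hq'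
  -- The single-cluster solution collects all positive weight.
  have htS : innerMat Gs.pos.lap 1 ≤ innerMat Gs.cost Xopt := by
    have h := hXopt.2 _ (Gs.isFeasible_clusterMat ⊤)
    have h0 : ∀ H : WGraph V, innerMat H.lap (clusterMat ⊤) = 0 := fun H => by
      rw [innerMat_lap]
      simp [clusterMat]
    rw [innerMat_cost, innerMat_adj_eq _ (clusterMat_self ⊤), h0, h0] at h
    linarith
  have ht0 : 0 ≤ innerMat Gs.pos.lap 1 := by
    rw [innerMat_lap_one]
    exact Finset.sum_nonneg fun i _ => Finset.sum_nonneg fun j _ => Gs.pos.weight_nonneg i j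
  obtain ⟨hM, hS6⟩ := hX.le_innerMat_sampleCov hε.1 hε.2 (ht0.trans htS)
  set R := Gs.sampleCov X with hR
  set p := agreeMat (Gs.noiseLaw q X) (Gs.clustering X) with hp
  have hfeas : Gs.IsFeasible R := Gs.isFeasible_sampleCov hX.posSemidef hM
  have hb := fun (i j : V) (hij : i ≠ j) => Gs.agreeMat_bounds hq hX.posSemidef hM hij
  simp only [← hR, ← hp] at hb
  have hpself : ∀ i, p i i = 1 := agreeMat_self _ _
  have hppsd : p.PosSemidef := agreeMat_posSemidef _ _ (Gs.measurableSet_clustering X)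
  have hone : (1 : Matrix V V ℝ).PosSemidef := Matrix.PosSemidef.one
  rw [(G.integral_value Gs X hq').2, innerMat_cost]
  have hS' := hXopt.2 R hfeas
  have hT := hpos.innerMat_le hone
  have hcR := hpos.innerMat_le hfeas.posSemidef
  have hN := (hneg.innerMat_le hppsd).2
  have hSR : innerMat Gs.cost R =
      innerMat Gs.neg.lap R + (innerMat Gs.pos.lap 1 - innerMat Gs.pos.lap R) := by
    rw [innerMat_cost, innerMat_adj_eq _ hfeas.diag_eq_one]
  have hc0 : 0 ≤ innerMat Gs.pos.lap R := by
    rw [innerMat_lap]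
    refine Finset.sum_nonneg fun i _ => Finset.sum_nonneg fun j _ =>
      mul_nonneg (Gs.pos.weight_nonneg i j) ?_
    rw [hfeas.diag_eq_one]
    linarith [(abs_apply_le_one hfeas.posSemidef hfeas.diag_eq_one i j).2]
  have hct : innerMat Gs.pos.lap R ≤ innerMat Gs.pos.lap 1 := by
    refine innerMat_lap_le _ fun i j h => ?_
    rw [hfeas.diag_eq_one, Matrix.one_apply_eq, Matrix.one_apply_ne h.ne]
    linarith [hfeas.nonneg_of_adj i j (Or.inl h)]
  -- Dissimilar pairs are compared in the sparsified instance, on whose edges `R` is nonnegative as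
  -- the bound on `1 - p` requires; `hN` then carries the result to the original instance.
  have hNR : 0.766 * innerMat Gs.neg.lap R ≤ innerMat Gs.neg.lap p := by
    rw [← innerMat_smul_right]
    refine innerMat_lap_le _ fun i j h => ?_
    have := (hb i j h.ne).2.2 (hfeas.nonneg_of_adj i j (Or.inr h))
    rw [hpself]
    simp only [Matrix.smul_apply, smul_eq_mul, hfeas.diag_eq_one]
    linarith
  have hadj : innerMat G.pos.adj R = innerMat G.pos.lap 1 - innerMat G.pos.lap R :=
    innerMat_adj_eq _ hfeas.diag_eq_one
  -- Similar pairs are compared in the original instance, where `R` may be negative on an edge; both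
  -- lower bounds for `p` hold for every correlation. Only afterwards is the cut of `R` transferred.
  have hA1 : 0.766 * innerMat G.pos.adj R ≤ innerMat G.pos.adj p := by
    rw [← innerMat_smul_right]
    exact innerMat_adj_le _ fun i j h => (hb i j h.ne).1
  have hA2 : 0.17 * innerMat G.pos.lap 1 + 0.46 * innerMat G.pos.adj R ≤
      innerMat G.pos.adj p := by
    rw [innerMat_lap_one, innerMat_adj, innerMat_adj, Finset.mul_sum, Finset.mul_sum,
      ← Finset.sum_add_distrib]
    simp only [Finset.mul_sum, ← Finset.sum_add_distrib]
    refine le_trans (le_of_eq ?_) (sum_weight_le_sum_weight G.pos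
      (Y := fun i j => 0.17 + 0.46 * R i j) (Z := p) fun i j h => (hb i j h.ne).2.1)
    exact Finset.sum_congr rfl fun i _ => Finset.sum_congr rfl fun j _ => by ring
  have hO := Instance.opt_le hτ0 (by linarith) hpos hneg hXopt
  have hN1 : (1 - τ) * (0.766 * innerMat Gs.neg.lap R) ≤
      (1 - τ ^ 2) * innerMat G.neg.lap p := by
    have := mul_le_mul_of_nonneg_left (hNR.trans hN) (show 0 ≤ 1 - τ by linarith)
    linarith
  have h2 : 0 < 1 - τ ^ 2 := by nlinarith
  have hC1 : (1 - τ ^ 2) * innerMat G.pos.lap R ≤ (1 + τ) * innerMat Gs.pos.lap R := by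
    have := mul_le_mul_of_nonneg_left hcR.1 (show 0 ≤ 1 + τ by linarith)
    linarith
  -- Here `E` and `O` are twice the expected and the optimal value, since the forms count ordered
  -- pairs.
  have key := combine_bounds hτ0 hτ1 hε.1 hκ hT.1 hT.2 hc0 hct htS hS' hS6 hO
    (E := innerMat G.neg.lap p + innerMat G.pos.adj p) (by
      have := mul_le_mul_of_nonneg_left hA1 h2.le
      rw [hadj] at this
      rw [hSR]
      linarith) (by
      have := mul_le_mul_of_nonneg_left hA2 h2.le
      rw [hadj] at this
      rw [hSR]
      linarith)
  linarith

end Rounding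

end CorrClust

theorem mainTheorem10 {V : Type*} [Fintype V] [DecidableEq V]
    (ε τ q : ℝ) (hε : ε ∈ Set.Ioo (0 : ℝ) (1 / 9)) (hτ : τ ∈ Set.Ioo (0 : ℝ) (1 / 9))
    (hq : q ∈ Set.Icc (0.13 : ℝ) 0.133)
    (G Gs : CorrClust.Instance V)
    (hpos : CorrClust.SpectrallyClose τ G.pos Gs.pos)
    (hneg : CorrClust.SpectrallyClose τ G.neg Gs.neg)
    (Xopt X : Matrix V V ℝ) (hXopt : Gs.IsOptimal Xopt) (hX : Gs.IsNearSolution ε Xopt X) :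
    Integrable (fun ω => G.value (Gs.clustering X ω)) (Gs.noiseLaw q X) ∧
      0.766 * (1 - 6 * ε - 3 * τ) * (1 - τ ^ 2) * G.opt
        ≤ ∫ ω, G.value (Gs.clustering X ω) ∂(Gs.noiseLaw q X) ∧
      ∫ ω, G.value (Gs.clustering X ω) ∂(Gs.noiseLaw q X) ≤ G.opt := by
  have hq' : q ∈ Set.Icc (0 : ℝ) 1 := ⟨by linarith [hq.1], by linarith [hq.2]⟩
  have := CorrClust.isProbabilityMeasure_noiseLaw Gs X hq'
  have hint := (G.integral_value Gs X hq').1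
  have h0 : 0 ≤ ∫ ω, G.value (Gs.clustering X ω) ∂(Gs.noiseLaw q X) :=
    integral_nonneg fun ω => G.value_nonneg _
  refine ⟨hint, ?_, ?_⟩
  -- Without vertices `maxDiag` defaults to `0` and the scaling factor is not positive, but every
  -- value is `0`.
  · rcases isEmpty_or_nonempty V with hV | hV
    · have : G.opt = 0 := by simp [CorrClust.Instance.opt, CorrClust.Instance.value]
      rw [this, mul_zero]
      exact h0
    rcases le_total 0 (1 - 6 * ε - 3 * τ) with hκ | hκ
    · exact CorrClust.Instance.le_integral_value hε hτ hq G Gs hpos hneg hκ hXopt hX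
    -- A nonpositive factor, which the ranges of `ε` and `τ` in fact exclude, makes the bound
    -- trivial because values are nonnegative.
    · refine le_trans ?_ h0
      have hopt : 0 ≤ G.opt := (G.value_nonneg ⊤).trans (G.value_le_opt ⊤)
      have h2 : 0 ≤ 1 - τ ^ 2 := by nlinarith [hτ.1, hτ.2]
      have : 0 ≤ (-(1 - 6 * ε - 3 * τ)) * ((1 - τ ^ 2) * G.opt) :=
        mul_nonneg (by linarith) (mul_nonneg h2 hopt)
      linarith
  · calc ∫ ω, G.value (Gs.clustering X ω) ∂(Gs.noiseLaw q X)
        ≤ ∫ _, G.opt ∂(Gs.noiseLaw q X) :=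
          integral_mono hint (integrable_const _) fun ω => G.value_le_opt _
      _ = G.opt := by simp
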